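/- Let $\mathfrak g$ be a finite-dimensional simple complex Lie algebra with Killing form $\langle\cdot,\cdot\rangle$, Cartan subalgebra $\mathfrak h$, a choice of simple roots with set of positive roots $\Delta_+$, $\mathfrak n_\pm=\bigoplus_{\alpha\in\Delta_+}\mathfrak g_{\pm\alpha}$, and root vectors $E_\alpha\in\mathfrak g_\alpha$ with $\langle E_\alpha,E_{-\alpha}\rangle=1$. Put $r_0=\sum_{\alpha\in\Delta_+}E_\alpha\wedge E_{-\alpha}$, where $a\wedge b=a\otimes b-b\otimes a$. Let $x_1,\dots,x_n$ be a basis of $\mathfrak h$, let $\lambda=\sum_i\lambda_i x_i^*$ be the corresponding coordinates on $\mathfrak h^*$, and let $U\subset\mathfrak h^*$ be a connected open set. A *dynamical r-matrix* on $U$ is a meromorphic function $r:U\to\mathfrak g\wedge\mathfrak g$ such that, wherever $r$ is holomorphic, $[h,r(\lambda)]=0$ for all $h\in\mathfrak h$ and $$\sum_i\Big(x_i^{(1)}\tfrac{\partial r^{23}}{\partial\lambda_i}-x_i^{(2)}\tfrac{\partial r^{13}}{\partial\lambda_i}+x_i^{(3)}\tfrac{\partial r^{12}}{\partial\lambda_i}\Big)+[r^{12},r^{13}]+[r^{12},r^{23}]+[r^{13},r^{23}]=[\Omega^{12},\Omega^{23}],$$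 where $\Omega\in(S^2\mathfrak g)^{\mathfrak g}$ is the Casimir element of the Killing form. On $\mathfrak g\oplus\mathfrak g$ consider the form $((X_1,Y_1),(X_2,Y_2))=\frac12(\langle Y_1,Y_2\rangle-\langle X_1,X_2\rangle)$. A Lie subalgebra is *Lagrangian* if it is isotropic of dimension $\dim\mathfrak g$. Identify $\mathfrak g$ with the diagonal, and $\mathfrak g^*$ with the subalgebra $\{(X_-+k,X_+-k): X_\pm\in\mathfrak n_\pm,\ k\in\mathfrak h\}$, paired with $\mathfrak g$ through the form. For $\tau\in\mathfrak g\wedge\mathfrak g$ let $\tau^\#:\mathfrak g^*\to\mathfrak g$ be given by $(a\otimes b)^\#\xi=\xi(b)a$. A *family of Lagrangian subalgebras* on $U$ is a holomorphic subbundle $W$ of $U\times(\mathfrak g\oplus\mathfrak g)$ whose fibres $W(\lambda)$ are Lagrangian subalgebras. It is *governed* by a dynamical r-matrix $r$ on $U$ if $$W(\lambda)=\{X+\tau(\lambda)^\#\xi+\xi : X\in\mathfrak h,\ \xi\in\mathfrak h^\perp\subset\mathfrak g^*\},\qquad \tau=r-r_0,$$ for every $\lambda\in U$ at which $r$ is holomorphic.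 **Statement.** Let $\mu\in U$ and let $W_0\subset\mathfrak g\oplus\mathfrak g$ be a Lagrangian subalgebra with $W_0\cap\mathfrak g=\mathfrak h$. Then there is one and only one family $W(\lambda)$, $\lambda\in U$, of Lagrangian subalgebras that is governed by some dynamical r-matrix on $U$ and satisfies $W(\mu)=W_0$. Moreover, the governing dynamical r-matrix of this family can be chosen to be holomorphic at exactly those $\lambda\in U$ for which $W(\lambda)\cap\mathfrak g=\mathfrak h$ (in particular at $\mu$). -/

import Mathlib

open scoped TensorProduct

noncomputable section

namespace DynamicalR

/-! ### Holomorphic and meromorphic functions of `n` complex variables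

Values lie in a finite-dimensional complex vector space, tested through linear functionals. -/

/-- `f` is holomorphic in a neighbourhood of `l`. -/
def HolAt {n : ℕ} {M : Type*} [AddCommGroup M] [Module ℂ M]
    (f : (Fin n → ℂ) → M) (l : Fin n → ℂ) : Prop :=
  ∀ φ : Module.Dual ℂ M, AnalyticAt ℂ (fun y => φ (f y)) l

/-- `f` is meromorphic on `U`: near every point of `U` it is a quotient `q / p` of a holomorphic
vector-valued function `q` by a holomorphic scalar function `p` that does not vanish identically
near that point. The value of `f` where `p` vanishes is immaterial. -/
def MeromorphicOnSet {n : ℕ} {M : Type*} [AddCommGroup M] [Module ℂ M]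
    (U : Set (Fin n → ℂ)) (f : (Fin n → ℂ) → M) : Prop :=
  ∀ l ∈ U, ∃ (p : (Fin n → ℂ) → ℂ) (q : (Fin n → ℂ) → M),
    AnalyticAt ℂ p l ∧ HolAt q l ∧ (¬ ∀ᶠ y in nhds l, p y = 0) ∧
      ∀ᶠ y in nhds l, p y ≠ 0 → f y = (p y)⁻¹ • q y

/-- The partial derivative `∂f/∂λᵢ` at `l`, computed in coordinates of the target. -/
def partialDeriv {n : ℕ} {M : Type*} [AddCommGroup M] [Module ℂ M] [FiniteDimensional ℂ M]
    (f : (Fin n → ℂ) → M) (i : Fin n) (l : Fin n → ℂ) : M :=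
  ∑ k, lineDeriv ℂ (fun y => (Module.finBasis ℂ M).repr (f y) k) l (Pi.single i 1) •
    Module.finBasis ℂ M k

/-! ### The classical dynamical Yang-Baxter equation -/

section Tensors

variable (𝔤 : Type*) [LieRing 𝔤] [LieAlgebra ℂ 𝔤]

/-- The Lie bracket as a linear map `a ⊗ b ↦ [a, b]`. -/
def bracketMap : 𝔤 ⊗[ℂ] 𝔤 →ₗ[ℂ] 𝔤 :=
  (LieModule.toModuleHom ℂ 𝔤 𝔤 : 𝔤 ⊗[ℂ] 𝔤 →ₗ[ℂ] 𝔤)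

variable {𝔤}

/-- `[s¹², t¹³]`. -/
def bracket12_13 (s t : 𝔤 ⊗[ℂ] 𝔤) : 𝔤 ⊗[ℂ] (𝔤 ⊗[ℂ] 𝔤) :=
  (bracketMap 𝔤).rTensor (𝔤 ⊗[ℂ] 𝔤)
    (TensorProduct.tensorTensorTensorComm ℂ 𝔤 𝔤 𝔤 𝔤 (s ⊗ₜ[ℂ] t))

/-- `[s¹², t²³]`. -/
def bracket12_23 (s t : 𝔤 ⊗[ℂ] 𝔤) : 𝔤 ⊗[ℂ] (𝔤 ⊗[ℂ] 𝔤) :=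
  (((bracketMap 𝔤).rTensor 𝔤 ∘ₗ (TensorProduct.assoc ℂ 𝔤 𝔤 𝔤).symm.toLinearMap).lTensor 𝔤)
    (TensorProduct.assoc ℂ 𝔤 𝔤 (𝔤 ⊗[ℂ] 𝔤) (s ⊗ₜ[ℂ] t))

/-- `[s¹³, t²³]`. -/
def bracket13_23 (s t : 𝔤 ⊗[ℂ] 𝔤) : 𝔤 ⊗[ℂ] (𝔤 ⊗[ℂ] 𝔤) :=
  TensorProduct.assoc ℂ 𝔤 𝔤 𝔤 ((bracketMap 𝔤).lTensor (𝔤 ⊗[ℂ] 𝔤)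
    (TensorProduct.tensorTensorTensorComm ℂ 𝔤 𝔤 𝔤 𝔤 (s ⊗ₜ[ℂ] t)))

theorem bracket12_13_tmul (a b c d : 𝔤) :
    bracket12_13 (a ⊗ₜ[ℂ] b) (c ⊗ₜ[ℂ] d) = ⁅a, c⁆ ⊗ₜ[ℂ] (b ⊗ₜ[ℂ] d) := by
  simp [bracket12_13, bracketMap]

theorem bracket12_23_tmul (a b c d : 𝔤) :
    bracket12_23 (a ⊗ₜ[ℂ] b) (c ⊗ₜ[ℂ] d) = a ⊗ₜ[ℂ] (⁅b, c⁆ ⊗ₜ[ℂ] d) := by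
  simp [bracket12_23, bracketMap]

theorem bracket13_23_tmul (a b c d : 𝔤) :
    bracket13_23 (a ⊗ₜ[ℂ] b) (c ⊗ₜ[ℂ] d) = a ⊗ₜ[ℂ] (c ⊗ₜ[ℂ] ⁅b, d⁆) := by
  simp [bracket13_23, bracketMap]

/-- `[r¹², r¹³] + [r¹², r²³] + [r¹³, r²³]`, which is `½ [r, r]` (Schouten bracket)
for skew-symmetric `r`. -/
def cyb (r : 𝔤 ⊗[ℂ] 𝔤) : 𝔤 ⊗[ℂ] (𝔤 ⊗[ℂ] 𝔤) :=
  bracket12_13 r r + bracket12_23 r r + bracket13_23 r r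

/-- `x¹ t²³ - x² t¹³ + x³ t¹²`, which is `x ∧ t` for skew-symmetric `t`. -/
def wedge3 (x : 𝔤) (t : 𝔤 ⊗[ℂ] 𝔤) : 𝔤 ⊗[ℂ] (𝔤 ⊗[ℂ] 𝔤) :=
  x ⊗ₜ[ℂ] t - TensorProduct.leftComm ℂ 𝔤 𝔤 𝔤 (x ⊗ₜ[ℂ] t) +
    TensorProduct.assoc ℂ 𝔤 𝔤 𝔤 (t ⊗ₜ[ℂ] x)

theorem wedge3_tmul (x a b : 𝔤) :
    wedge3 x (a ⊗ₜ[ℂ] b) =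
      x ⊗ₜ[ℂ] (a ⊗ₜ[ℂ] b) - a ⊗ₜ[ℂ] (x ⊗ₜ[ℂ] b) + a ⊗ₜ[ℂ] (b ⊗ₜ[ℂ] x) := by
  simp [wedge3]

/-- The map `t^# : 𝔤* → 𝔤` of a tensor, `(a ⊗ b)^# ξ = ξ(b) a`. -/
def sharp (t : 𝔤 ⊗[ℂ] 𝔤) (ξ : Module.Dual ℂ 𝔤) : 𝔤 :=
  TensorProduct.rid ℂ 𝔤 (ξ.lTensor 𝔤 t)

theorem sharp_tmul (a b : 𝔤) (ξ : Module.Dual ℂ 𝔤) :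
    sharp (a ⊗ₜ[ℂ] b) ξ = ξ b • a := by
  simp [sharp]

end Tensors

section LieTheory

variable {𝔤 : Type*} [LieRing 𝔤] [LieAlgebra ℂ 𝔤] [FiniteDimensional ℂ 𝔤]
  [LieAlgebra.IsKilling ℂ 𝔤]

variable (𝔤) in
/-- The Casimir element `Ω ∈ (S² 𝔤)^𝔤` of the Killing form. -/
def casimir : 𝔤 ⊗[ℂ] 𝔤 :=
  ∑ k, Module.finBasis ℂ 𝔤 k ⊗ₜ[ℂ]
    LinearMap.BilinForm.dualBasis (killingForm ℂ 𝔤)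
      (LieAlgebra.IsKilling.killingForm_nondegenerate ℂ 𝔤) (Module.finBasis ℂ 𝔤) k

variable (H : LieSubalgebra ℂ 𝔤)

/-- A dynamical r-matrix on `U ⊆ 𝔥*` (coupling constant `2`): a meromorphic function
`r : U → 𝔤 ∧ 𝔤` of weight zero that satisfies the modified classical dynamical
Yang-Baxter equation `Alt(dr) + ½ [r, r] = [Ω¹², Ω²³]`. Here `x` is a basis of `𝔥` and
a point `l` stands for `∑ lᵢ xᵢ* ∈ 𝔥*`. The equations are imposed where `r` is holomorphic. -/
structure IsDynamicalRMatrix {n : ℕ} (x : Module.Basis (Fin n) ℂ H)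
    (U : Set (Fin n → ℂ)) (r : (Fin n → ℂ) → 𝔤 ⊗[ℂ] 𝔤) : Prop where
  meromorphic : MeromorphicOnSet U r
  skew : ∀ l ∈ U, HolAt r l → TensorProduct.comm ℂ 𝔤 𝔤 (r l) = - r l
  weight_zero : ∀ l ∈ U, HolAt r l → ∀ h ∈ H, ⁅h, r l⁆ = 0
  cdybe : ∀ l ∈ U, HolAt r l →
    ∑ i, wedge3 (x i : 𝔤) (partialDeriv r i l) + cyb (r l)
      = bracket12_23 (casimir 𝔤) (casimir 𝔤)

/-! ### The double `𝔤 ⊕ 𝔤` -/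

/-- The invariant form `½ (⟨Y₁, Y₂⟩ - ⟨X₁, X₂⟩)` on `𝔤 ⊕ 𝔤`. -/
def doubleForm (z w : 𝔤 × 𝔤) : ℂ :=
  (1 / 2) * (killingForm ℂ 𝔤 z.2 w.2 - killingForm ℂ 𝔤 z.1 w.1)

/-- Lagrangian subalgebras: isotropic of half the dimension. -/
structure IsLagrangian (W : LieSubalgebra ℂ (𝔤 × 𝔤)) : Prop where
  isotropic : ∀ z ∈ W, ∀ w ∈ W, doubleForm z w = 0
  finrank_eq : Module.finrank ℂ W = Module.finrank ℂ 𝔤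

/-- `W ∩ 𝔤 = 𝔥`, where `𝔤` is the diagonal of `𝔤 ⊕ 𝔤`. -/
def MeetsDiagonalIn (W : LieSubalgebra ℂ (𝔤 × 𝔤)) : Prop :=
  ∀ X : 𝔤, (X, X) ∈ W ↔ X ∈ H

/-- A (holomorphic) family of Lagrangian subalgebras parametrized by `U`: every `W l` is
a Lagrangian subalgebra, and the `W l` form a holomorphic subbundle of `U × (𝔤 ⊕ 𝔤)`. -/
structure IsLagrangianFamily {n : ℕ} (U : Set (Fin n → ℂ))
    (W : (Fin n → ℂ) → LieSubalgebra ℂ (𝔤 × 𝔤)) : Prop where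
  lagrangian : ∀ l ∈ U, IsLagrangian (W l)
  holomorphic : ∀ l ∈ U, ∃ (d : ℕ) (s : Fin d → (Fin n → ℂ) → 𝔤 × 𝔤),
    (∀ j, HolAt (s j) l) ∧ ∀ᶠ y in nhds l,
      LinearIndependent ℂ (fun j => s j y) ∧
        Submodule.span ℂ (Set.range fun j => s j y) = (W y).toSubmodule

variable [H.IsCartanSubalgebra] (b : (LieAlgebra.IsKilling.rootSystem H).Base)

/-- `𝔫₊`, the sum of the root spaces of the positive roots. -/
def nPos : Submodule ℂ 𝔤 :=
  ⨆ α : H.root, ⨆ _ : b.IsPos α, (LieAlgebra.rootSpace H α.1).toSubmodule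

/-- `𝔫₋`, the sum of the root spaces of the negative roots. -/
def nNeg : Submodule ℂ 𝔤 :=
  ⨆ α : H.root, ⨆ _ : b.IsPos α, (LieAlgebra.rootSpace H (-α.1)).toSubmodule

open Classical in
/-- The standard r-matrix `r₀ = ∑_{α > 0} E_α ∧ E_{-α}`. -/
def standardR (E : LieModule.Weight ℂ H 𝔤 → 𝔤) : 𝔤 ⊗[ℂ] 𝔤 :=
  ∑ α : H.root, if b.IsPos α then
    E α.1 ⊗ₜ[ℂ] E (-α.1) - E (-α.1) ⊗ₜ[ℂ] E α.1 else 0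

/-- The point of the double `𝔤 ⊕ 𝔤` that represents `ξ ∈ 𝔤*`: the dual Lie algebra `𝔤*` of the
Lie bialgebra `(𝔤, 𝔤*, r₀)` is the subalgebra `{(X₋ + k, X₊ - k)}`, which is paired with the
diagonal `𝔤` through the invariant form. -/
def Represents (e : 𝔤 × 𝔤) (ξ : Module.Dual ℂ 𝔤) : Prop :=
  (∃ Xm ∈ nNeg H b, ∃ Xp ∈ nPos H b, ∃ k ∈ H, e = (Xm + k, Xp - k)) ∧
    ∀ Z : 𝔤, doubleForm e (Z, Z) = ξ Z

/-- The subspace `{X + τ^# ξ + ξ | X ∈ 𝔥, ξ ∈ 𝔥^⊥} ⊆ 𝔤 ⊕ 𝔤* ≅ 𝔤 ⊕ 𝔤` with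
characteristic pair `(𝔥, τ)`. -/
def characteristicSpace (τ : 𝔤 ⊗[ℂ] 𝔤) : Set (𝔤 × 𝔤) :=
  {z | ∃ X ∈ H, ∃ ξ : Module.Dual ℂ 𝔤, (∀ h ∈ H, ξ h = 0) ∧ ∃ e : 𝔤 × 𝔤,
    Represents H b e ξ ∧ z = (X, X) + (sharp τ ξ, sharp τ ξ) + e}

/-- The family `W` is governed by `r = r₀ + τ`: wherever `r` is holomorphic, `W l` has
characteristic pair `(𝔥, τ(l))`. -/
def IsGovernedBy {n : ℕ} (E : LieModule.Weight ℂ H 𝔤 → 𝔤) (U : Set (Fin n → ℂ))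
    (W : (Fin n → ℂ) → LieSubalgebra ℂ (𝔤 × 𝔤)) (r : (Fin n → ℂ) → 𝔤 ⊗[ℂ] 𝔤) : Prop :=
  ∀ l ∈ U, HolAt r l →
    (W l : Set (𝔤 × 𝔤)) = characteristicSpace H b (r l - standardR H b E)

end LieTheory

end DynamicalR

end

open scoped TensorProduct

noncomputable section

set_option linter.unusedSectionVars false

namespace DynamicalR

section

open LieAlgebra LieAlgebra.IsKilling LieModule

variable {𝔤 : Type*} [LieRing 𝔤] [LieAlgebra ℂ 𝔤] [FiniteDimensional ℂ 𝔤] [IsKilling ℂ 𝔤]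

/-! ### The Killing form and root vectors -/

/-! Bracketing with the diagonal `𝔥` splits a Lagrangian subalgebra `W` with `W ∩ 𝔤 = 𝔥` into weight
vectors: it is the diagonal `𝔥` plus one line for each root, spanned by the Cayley vector `((φ α -
1) E α, (φ α + 1) E α)` (`exists_cayley`, `HasCayleyVectors.eq_cayleySpace`). Isotropy forces `φ
(-α) = -φ α` and a quadratic relation on triples of roots with sum zero. On the other side, `r₀`
acts as `1` on `𝔫₊` and as `-1` on `𝔫₋`, so being governed by `r` means being the Cayley space of
the operator of `r` (`characteristicSpace_eq`), and `φ α` is the eigenvalue of that operator on `E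
α`.

For a weight-zero skew `r`, the dynamical equation evaluated on `(h, E (-α), E α)` is the Riccati
equation `∂ᵢ φ α = (1 - φ α ^ 2) αᵢ` (`deriv_of_cdybe`); conversely, the Riccati equation and the
relations on triples give back the whole equation for `∑ φ α E α ⊗ E (-α)` (`cdybe_rootTensor`).
Since `(φ + 1) / (φ - 1)` then varies as `exp (2α)`, the flow on Cayley lines is the automorphism
`(exp (-ad h), exp (ad h))` of the double, with `h ∈ 𝔥` corresponding to `l - μ`. The family must be
`W l = twist (l - μ) W₀`.

Existence: the twist preserves Lagrangian subalgebras and depends holomorphically on `l`; a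
coefficient of the r-matrix has a pole exactly when a transported Cayley vector becomes diagonal,
which is when `W l ∩ 𝔤` exceeds `𝔥`.

Uniqueness: where the r-matrix is holomorphic the Riccati equation makes the untwisted family
locally constant (`eventually_twist_mem`). Holomorphy of the subbundle and the identity theorem
carry this across the poles (`untwist_locally_constant`), and connectedness of `U` finishes. The `𝔥
∧ 𝔥` part of `r` never enters, so the family is unique although `r` need not be. -/

theorem killing_comm (X Y : 𝔤) : killingForm ℂ 𝔤 X Y = killingForm ℂ 𝔤 Y X :=
  LieModule.traceForm_comm ℂ 𝔤 𝔤 X Y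

theorem killing_lie (X Y Z : 𝔤) : killingForm ℂ 𝔤 ⁅X, Y⁆ Z = killingForm ℂ 𝔤 X ⁅Y, Z⁆ :=
  LieModule.traceForm_apply_lie_apply ℂ 𝔤 𝔤 X Y Z

theorem eq_zero_of_killing {X : 𝔤} (h : ∀ Y, killingForm ℂ 𝔤 X Y = 0) : X = 0 := by
  have : X ∈ LinearMap.ker (killingForm ℂ 𝔤) := by
    rw [LinearMap.mem_ker]; ext Y; simpa using h Y
  simpa using this

variable {H : LieSubalgebra ℂ 𝔤} [H.IsCartanSubalgebra]

theorem neg_mem_root {α : Weight ℂ H 𝔤} (hα : α ∈ H.root) : -α ∈ H.root := by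
  simpa using hα

theorem mem_rootSpace_zero {X : 𝔤} : X ∈ rootSpace H (0 : H → ℂ) ↔ X ∈ H := by
  simp

theorem root_ne_zero {α : Weight ℂ H 𝔤} (hα : α ∈ H.root) : (α : H → ℂ) ≠ 0 := by
  simpa using hα

/-- The element of `𝔥` dual to a linear functional under the Killing form. -/
theorem killing_cartanEquivDual_symm (χ : Module.Dual ℂ H) (h : H) :
    killingForm ℂ 𝔤 ((cartanEquivDual H).symm χ : H) h = χ h :=
  LinearMap.BilinForm.apply_toDual_symm_apply (hB := traceForm_cartan_nondegenerate ℂ 𝔤 H) _ _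

theorem eq_zero_of_killing_cartan {h : 𝔤} (hh : h ∈ H)
    (h0 : ∀ k ∈ H, killingForm ℂ 𝔤 h k = 0) : h = 0 := by
  have : cartanEquivDual H ⟨h, hh⟩ = 0 := by
    ext k
    exact h0 k k.2
  exact congrArg Subtype.val ((cartanEquivDual H).map_eq_zero_iff.1 this)

variable {E : Weight ℂ H 𝔤 → 𝔤}

/-- Root vectors normalized by the Killing form. -/
structure IsRootVectors (E : Weight ℂ H 𝔤 → 𝔤) : Prop where
  mem : ∀ α ∈ H.root, E α ∈ rootSpace H α
  pair : ∀ α ∈ H.root, killingForm ℂ 𝔤 (E α) (E (-α)) = 1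

theorem IsRootVectors.killing (hE : IsRootVectors E) [DecidableEq (Weight ℂ H 𝔤)]
    {α β : Weight ℂ H 𝔤} (hα : α ∈ H.root)
    (hβ : β ∈ H.root) : killingForm ℂ 𝔤 (E (-α)) (E β) = if α = β then 1 else 0 := by
  split_ifs with h
  · subst h
    rw [killing_comm, hE.pair _ hα]
  · refine killingForm_apply_eq_zero_of_mem_rootSpace_of_add_ne_zero ℂ 𝔤 H
      (hE.mem _ (neg_mem_root hα)) (hE.mem _ hβ) fun h0 => h ?_
    ext z
    have := congrFun h0 z
    simp only [Weight.coe_neg, Pi.add_apply, Pi.neg_apply, Pi.zero_apply] at this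
    linear_combination -this

theorem IsRootVectors.ne_zero (hE : IsRootVectors E) {α : Weight ℂ H 𝔤} (hα : α ∈ H.root) :
    E α ≠ 0 := by
  intro h
  have := hE.pair _ hα
  simp [h] at this

theorem IsRootVectors.killing_cartan (hE : IsRootVectors E) {α : Weight ℂ H 𝔤} (hα : α ∈ H.root)
    {h : 𝔤} (hh : h ∈ H) : killingForm ℂ 𝔤 (E α) h = 0 :=
  killingForm_apply_eq_zero_of_mem_rootSpace_of_add_ne_zero ℂ 𝔤 H
    (hE.mem _ hα) (mem_rootSpace_zero.2 hh) (by simpa using root_ne_zero hα)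

theorem IsRootVectors.notMem_cartan (hE : IsRootVectors E) {α : Weight ℂ H 𝔤} (hα : α ∈ H.root) :
    E α ∉ H := by
  intro h
  have := hE.killing_cartan (neg_mem_root hα) h
  rw [killing_comm, hE.pair _ hα] at this
  exact one_ne_zero this

theorem IsRootVectors.eq_smul (hE : IsRootVectors E) {α : Weight ℂ H 𝔤} (hα : α ∈ H.root)
    {X : 𝔤} (hX : X ∈ rootSpace H α) : X = killingForm ℂ 𝔤 (E (-α)) X • E α := by
  have h1 := finrank_rootSpace_eq_one α (by simpa using hα)
  obtain ⟨c, hc⟩ := (finrank_eq_one_iff_of_nonzero' (⟨E α, hE.mem _ hα⟩ : rootSpace H α)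
    (fun h => hE.ne_zero hα (congrArg Subtype.val h))).1 h1 ⟨X, hX⟩
  have hc' : c • E α = X := congrArg Subtype.val hc
  rw [← hc', map_smul, killing_comm, hE.pair _ hα]
  simp

theorem IsRootVectors.lie_cartan (hE : IsRootVectors E) {α : Weight ℂ H 𝔤} (hα : α ∈ H.root)
    (h : H) : ⁅(h : 𝔤), E α⁆ = α h • E α :=
  lie_eq_smul_of_mem_rootSpace (hE.mem _ hα) h

theorem lie_cartan_cartan {h k : 𝔤} (hh : h ∈ H) (hk : k ∈ H) : ⁅h, k⁆ = 0 := by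
  have : ⁅(⟨h, hh⟩ : H), (⟨k, hk⟩ : H)⁆ = 0 := trivial_lie_zero _ _ _ _
  simpa [Subtype.ext_iff] using this

/-- The operator that vanishes on `𝔥` and multiplies `E α` by `c α`. -/
def rootOp (E : Weight ℂ H 𝔤 → 𝔤) (c : Weight ℂ H 𝔤 → ℂ) : 𝔤 →ₗ[ℂ] 𝔤 :=
  ∑ α ∈ H.root, c α • (killingForm ℂ 𝔤 (E (-α))).smulRight (E α)

theorem rootOp_apply (c : Weight ℂ H 𝔤 → ℂ) (X : 𝔤) :
    rootOp E c X = ∑ α ∈ H.root, (c α * killingForm ℂ 𝔤 (E (-α)) X) • E α := by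
  simp [rootOp, LinearMap.sum_apply, mul_smul]

theorem IsRootVectors.rootOp_root (hE : IsRootVectors E) (c : Weight ℂ H 𝔤 → ℂ)
    {α : Weight ℂ H 𝔤} (hα : α ∈ H.root) : rootOp E c (E α) = c α • E α := by
  classical
  rw [rootOp_apply, Finset.sum_eq_single α]
  · rw [hE.killing hα hα]; simp
  · intro β hβ hne
    rw [hE.killing hβ hα]; simp [hne]
  · exact fun h => (h hα).elim

theorem IsRootVectors.rootOp_cartan (hE : IsRootVectors E) (c : Weight ℂ H 𝔤 → ℂ)
    {h : 𝔤} (hh : h ∈ H) : rootOp E c h = 0 := by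
  rw [rootOp_apply]
  refine Finset.sum_eq_zero fun α hα => ?_
  rw [hE.killing_cartan (neg_mem_root hα) hh]; simp

theorem IsRootVectors.cartan_part_mem (hE : IsRootVectors E) (X : 𝔤) :
    X - rootOp E 1 X ∈ H := by
  have key : (⊤ : LieSubmodule ℂ H 𝔤) ≤ ⨆ χ : Weight ℂ H 𝔤, rootSpace H χ := by
    rw [← iSup_genWeightSpace_eq_top' ℂ H 𝔤]
  have hX : X ∈ ⨆ χ : Weight ℂ H 𝔤, rootSpace H χ := key (LieSubmodule.mem_top X)
  induction hX using LieSubmodule.iSup_induction' with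
  | mem α X hX =>
    by_cases hα : α ∈ H.root
    · have h1 : rootOp E 1 X = X := by
        rw [hE.eq_smul hα hX, map_smul, hE.rootOp_root _ hα]
        simp
      rw [h1, sub_self]
      exact H.zero_mem
    · have hα0 : α.IsZero := by simpa using hα
      have : X ∈ H := by
        rw [Weight.IsZero] at hα0
        rw [hα0] at hX
        exact mem_rootSpace_zero.1 hX
      rw [hE.rootOp_cartan _ this, sub_zero]
      exact this
  | zero => simp
  | add X Y _ _ hX hY =>
    rw [map_add, add_sub_add_comm]
    exact H.add_mem hX hY

theorem IsRootVectors.eq_cartan_add (hE : IsRootVectors E) (X : 𝔤) :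
    ∃ h ∈ H, X = h + ∑ α ∈ H.root, killingForm ℂ 𝔤 (E (-α)) X • E α := by
  refine ⟨_, hE.cartan_part_mem X, ?_⟩
  rw [rootOp_apply]
  simp

theorem IsRootVectors.linearMap_ext (hE : IsRootVectors E) {M : Type*} [AddCommGroup M]
    [Module ℂ M] {f g : 𝔤 →ₗ[ℂ] M} (hH : ∀ h ∈ H, f h = g h)
    (hr : ∀ α ∈ H.root, f (E α) = g (E α)) : f = g := by
  ext X
  obtain ⟨h, hh, hX⟩ := hE.eq_cartan_add X
  rw [hX, map_add, map_add, hH h hh, map_sum, map_sum]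
  congr 1
  refine Finset.sum_congr rfl fun α hα => ?_
  rw [map_smul, map_smul, hr α hα]

/-- Elements orthogonal to `𝔥` are combinations of root vectors. -/
theorem IsRootVectors.eq_sum_of_orthogonal (hE : IsRootVectors E) {Y : 𝔤}
    (hY : ∀ h ∈ H, killingForm ℂ 𝔤 Y h = 0) :
    Y = ∑ α ∈ H.root, killingForm ℂ 𝔤 (E (-α)) Y • E α := by
  obtain ⟨h, hh, hX⟩ := hE.eq_cartan_add Y
  have : h = 0 := by
    refine eq_zero_of_killing_cartan hh fun k hk => ?_
    have h1 := hY k hk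
    rw [hX, map_add, LinearMap.add_apply, map_sum, LinearMap.sum_apply, Finset.sum_eq_zero,
      add_zero] at h1
    · exact h1
    · intro α hα
      simp [hE.killing_cartan hα hk]
  rw [this, zero_add] at hX
  exact hX

/-- An element with vanishing root coordinates lies in `𝔥`. -/
theorem IsRootVectors.mem_cartan_of_killing (hE : IsRootVectors E) {X : 𝔤}
    (h : ∀ α ∈ H.root, killingForm ℂ 𝔤 (E (-α)) X = 0) : X ∈ H := by
  obtain ⟨k, hk, hX⟩ := hE.eq_cartan_add X
  rw [hX, Finset.sum_eq_zero, add_zero]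
  · exact hk
  · intro α hα; simp [h α hα]

end

section

open LieAlgebra LieAlgebra.IsKilling LieModule

variable {𝔤 : Type*} [LieRing 𝔤] [LieAlgebra ℂ 𝔤] [FiniteDimensional ℂ 𝔤] [IsKilling ℂ 𝔤]

/-! ### Tensors as operators -/

/-- The operator `X ↦ ⟨b, X⟩ a` attached to `a ⊗ b`. -/
def tensorOp : 𝔤 ⊗[ℂ] 𝔤 →ₗ[ℂ] 𝔤 →ₗ[ℂ] 𝔤 :=
  TensorProduct.lift <| LinearMap.mk₂ ℂ (fun a b => (killingForm ℂ 𝔤 b).smulRight a)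
    (fun a a' b => by ext; simp) (fun c a b => by ext; simp [smul_comm c])
    (fun a b b' => by ext; simp [add_smul]) (fun c a b => by ext; simp [mul_smul])

@[simp] theorem tensorOp_tmul (a b X : 𝔤) :
    tensorOp (a ⊗ₜ[ℂ] b) X = killingForm ℂ 𝔤 b X • a := by
  simp [tensorOp]

theorem sharp_add (s t : 𝔤 ⊗[ℂ] 𝔤) (ξ : Module.Dual ℂ 𝔤) :
    sharp (s + t) ξ = sharp s ξ + sharp t ξ := by
  simp [sharp]

theorem sharp_killing (t : 𝔤 ⊗[ℂ] 𝔤) (X : 𝔤) : sharp t (killingForm ℂ 𝔤 X) = tensorOp t X := by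
  induction t with
  | zero => simp [sharp]
  | tmul a b => rw [sharp_tmul, tensorOp_tmul, killing_comm]
  | add s t hs ht => rw [sharp_add, hs, ht, map_add, LinearMap.add_apply]

theorem killing_tensorOp_comm (t : 𝔤 ⊗[ℂ] 𝔤) (X Y : 𝔤) :
    killingForm ℂ 𝔤 X (tensorOp (TensorProduct.comm ℂ 𝔤 𝔤 t) Y)
      = killingForm ℂ 𝔤 (tensorOp t X) Y := by
  induction t with
  | zero => simp
  | tmul a b =>
    simp [killing_comm X b, mul_comm]
  | add s t hs ht => simp [hs, ht]

theorem tensorOp_lie (h : 𝔤) (t : 𝔤 ⊗[ℂ] 𝔤) (X : 𝔤) :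
    tensorOp ⁅h, t⁆ X = ⁅h, tensorOp t X⁆ - tensorOp t ⁅h, X⁆ := by
  induction t with
  | zero => simp
  | tmul a b =>
    have : killingForm ℂ 𝔤 ⁅h, b⁆ X = - killingForm ℂ 𝔤 b ⁅h, X⁆ := by
      rw [← lie_skew, map_neg, LinearMap.neg_apply, killing_lie]
    simp [TensorProduct.LieModule.lie_tmul_right, this, sub_eq_add_neg]
  | add s t hs ht => simp [hs, ht]; abel

/-- The pairing of a threefold tensor with three vectors under the Killing form. -/
def pair3 (X Y Z : 𝔤) : 𝔤 ⊗[ℂ] (𝔤 ⊗[ℂ] 𝔤) →ₗ[ℂ] ℂ :=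
  LinearMap.mul' ℂ ℂ ∘ₗ TensorProduct.map (killingForm ℂ 𝔤 X)
    (LinearMap.mul' ℂ ℂ ∘ₗ TensorProduct.map (killingForm ℂ 𝔤 Y) (killingForm ℂ 𝔤 Z))

@[simp] theorem pair3_tmul (X Y Z a b c : 𝔤) :
    pair3 X Y Z (a ⊗ₜ[ℂ] (b ⊗ₜ[ℂ] c)) =
      killingForm ℂ 𝔤 X a * (killingForm ℂ 𝔤 Y b * killingForm ℂ 𝔤 Z c) := by
  simp [pair3]

/-- Pairings with a basis are the coordinates in the tensor cube of its Killing-dual basis. -/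
theorem eq_of_pair3 {S T : 𝔤 ⊗[ℂ] (𝔤 ⊗[ℂ] 𝔤)} (h : ∀ X Y Z, pair3 X Y Z S = pair3 X Y Z T) :
    S = T := by
  let e := Module.finBasis ℂ 𝔤
  let B := LinearMap.BilinForm.dualBasis (killingForm ℂ 𝔤) (killingForm_nondegenerate ℂ 𝔤) e
  have hrep : ∀ (X : 𝔤) i, B.repr X i = killingForm ℂ 𝔤 (e i) X := by
    intro X i
    rw [LinearMap.BilinForm.dualBasis_repr_apply, killing_comm]
  let BB := B.tensorProduct (B.tensorProduct B)
  have hBB : ∀ T i j k, BB.repr T (i, j, k) = pair3 (e i) (e j) (e k) T := by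
    intro T i j k
    have : BB.coord (i, j, k) = pair3 (e i) (e j) (e k) := by
      ext a b c
      simp [BB, hrep]
      ring
    rw [← this]; rfl
  refine BB.repr.injective (Finsupp.ext fun ⟨i, j, k⟩ => ?_)
  rw [hBB, hBB, h]

/-! ### The terms of the dynamical Yang-Baxter equation as trilinear forms -/

theorem pair3_bracket12_13 (X Y Z : 𝔤) (s t : 𝔤 ⊗[ℂ] 𝔤) :
    pair3 X Y Z (bracket12_13 s t) = killingForm ℂ 𝔤 X ⁅tensorOp s Y, tensorOp t Z⁆ := by
  induction s with
  | zero => simp [bracket12_13]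
  | tmul a b =>
    induction t with
    | zero => simp [bracket12_13]
    | tmul c d =>
      rw [bracket12_13_tmul]
      simp [killing_comm Y b, killing_comm Z d]
      ring
    | add t t' h h' =>
      have : bracket12_13 (a ⊗ₜ[ℂ] b) (t + t') =
          bracket12_13 (a ⊗ₜ[ℂ] b) t + bracket12_13 (a ⊗ₜ[ℂ] b) t' := by
        simp only [bracket12_13, TensorProduct.tmul_add, map_add]
      rw [this, map_add, h, h']
      simp
  | add s s' h h' =>
    have : bracket12_13 (s + s') t = bracket12_13 s t + bracket12_13 s' t := by
      simp only [bracket12_13, TensorProduct.add_tmul, map_add]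
    rw [this, map_add, h, h']
    simp

theorem pair3_bracket12_23 (X Y Z : 𝔤) (s t : 𝔤 ⊗[ℂ] 𝔤) :
    pair3 X Y Z (bracket12_23 s t) =
      killingForm ℂ 𝔤 Y ⁅tensorOp (TensorProduct.comm ℂ 𝔤 𝔤 s) X, tensorOp t Z⁆ := by
  induction s with
  | zero => simp [bracket12_23]
  | tmul a b =>
    induction t with
    | zero => simp [bracket12_23]
    | tmul c d =>
      rw [bracket12_23_tmul]
      simp [killing_comm X a, killing_comm Z d]
      ring
    | add t t' h h' =>
      have : bracket12_23 (a ⊗ₜ[ℂ] b) (t + t') =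
          bracket12_23 (a ⊗ₜ[ℂ] b) t + bracket12_23 (a ⊗ₜ[ℂ] b) t' := by
        simp only [bracket12_23, TensorProduct.tmul_add, map_add]
      rw [this, map_add, h, h']
      simp
  | add s s' h h' =>
    have : bracket12_23 (s + s') t = bracket12_23 s t + bracket12_23 s' t := by
      simp only [bracket12_23, TensorProduct.add_tmul, map_add]
    rw [this, map_add, h, h']
    simp

theorem pair3_bracket13_23 (X Y Z : 𝔤) (s t : 𝔤 ⊗[ℂ] 𝔤) :
    pair3 X Y Z (bracket13_23 s t) =
      killingForm ℂ 𝔤 Z ⁅tensorOp (TensorProduct.comm ℂ 𝔤 𝔤 s) X,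
        tensorOp (TensorProduct.comm ℂ 𝔤 𝔤 t) Y⁆ := by
  induction s with
  | zero => simp [bracket13_23]
  | tmul a b =>
    induction t with
    | zero => simp [bracket13_23]
    | tmul c d =>
      rw [bracket13_23_tmul]
      simp [killing_comm X a, killing_comm Y c]
      ring
    | add t t' h h' =>
      have : bracket13_23 (a ⊗ₜ[ℂ] b) (t + t') =
          bracket13_23 (a ⊗ₜ[ℂ] b) t + bracket13_23 (a ⊗ₜ[ℂ] b) t' := by
        simp only [bracket13_23, TensorProduct.tmul_add, map_add]
      rw [this, map_add, h, h']
      simp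
  | add s s' h h' =>
    have : bracket13_23 (s + s') t = bracket13_23 s t + bracket13_23 s' t := by
      simp only [bracket13_23, TensorProduct.add_tmul, map_add]
    rw [this, map_add, h, h']
    simp

theorem pair3_wedge3 (X Y Z x : 𝔤) (t : 𝔤 ⊗[ℂ] 𝔤) :
    pair3 X Y Z (wedge3 x t) =
      killingForm ℂ 𝔤 x X * killingForm ℂ 𝔤 Y (tensorOp t Z)
      - killingForm ℂ 𝔤 x Y * killingForm ℂ 𝔤 X (tensorOp t Z)
      + killingForm ℂ 𝔤 x Z * killingForm ℂ 𝔤 X (tensorOp t Y) := by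
  induction t with
  | zero => simp [wedge3]
  | tmul a b =>
    rw [wedge3_tmul]
    simp [killing_comm x, killing_comm b]
    ring
  | add s t hs ht =>
    have : wedge3 x (s + t) = wedge3 x s + wedge3 x t := by
      simp only [wedge3, TensorProduct.tmul_add, TensorProduct.add_tmul, map_add]; abel
    rw [this, map_add, hs, ht]
    simp
    ring

theorem tensorOp_casimir (X : 𝔤) : tensorOp (casimir 𝔤) X = X := by
  let e := Module.finBasis ℂ 𝔤
  let B := LinearMap.BilinForm.dualBasis (killingForm ℂ 𝔤) (killingForm_nondegenerate ℂ 𝔤) e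
  have h1 : ∀ i, killingForm ℂ 𝔤 (B i) X = e.repr X i := by
    intro i
    conv_lhs => rw [← e.sum_repr X]
    simp only [map_sum, map_smul, B, LinearMap.BilinForm.apply_dualBasis_left]
    simp
  simp only [casimir, map_sum, LinearMap.sum_apply, tensorOp_tmul]
  conv_rhs => rw [← e.sum_repr X]
  exact Finset.sum_congr rfl fun i _ => by rw [← h1]

theorem tensorOp_comm_casimir (X : 𝔤) :
    tensorOp (TensorProduct.comm ℂ 𝔤 𝔤 (casimir 𝔤)) X = X := by
  rw [← sub_eq_zero]
  refine eq_zero_of_killing fun Y => ?_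
  rw [killing_comm, map_sub, killing_tensorOp_comm, tensorOp_casimir, sub_self]

/-- The equation `∑ xᵢ ∧ tᵢ + ½ [r, r] = [Ω¹², Ω²³]` as an identity of trilinear forms,
in terms of operators. -/
theorem cdybe_iff {ι : Type*} [Fintype ι] (x : ι → 𝔤) (t : ι → 𝔤 ⊗[ℂ] 𝔤) (r : 𝔤 ⊗[ℂ] 𝔤)
    (hr : TensorProduct.comm ℂ 𝔤 𝔤 r = - r) :
    ∑ i, wedge3 (x i) (t i) + cyb r = bracket12_23 (casimir 𝔤) (casimir 𝔤) ↔
    ∀ X Y Z : 𝔤,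
      ∑ i, (killingForm ℂ 𝔤 (x i) X * killingForm ℂ 𝔤 Y (tensorOp (t i) Z)
        - killingForm ℂ 𝔤 (x i) Y * killingForm ℂ 𝔤 X (tensorOp (t i) Z)
        + killingForm ℂ 𝔤 (x i) Z * killingForm ℂ 𝔤 X (tensorOp (t i) Y))
      + (killingForm ℂ 𝔤 X ⁅tensorOp r Y, tensorOp r Z⁆
        - killingForm ℂ 𝔤 Y ⁅tensorOp r X, tensorOp r Z⁆
        + killingForm ℂ 𝔤 Z ⁅tensorOp r X, tensorOp r Y⁆)
      = killingForm ℂ 𝔤 Y ⁅X, Z⁆ := by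
  have key : ∀ X Y Z : 𝔤, pair3 X Y Z (∑ i, wedge3 (x i) (t i) + cyb r) =
      ∑ i, (killingForm ℂ 𝔤 (x i) X * killingForm ℂ 𝔤 Y (tensorOp (t i) Z)
        - killingForm ℂ 𝔤 (x i) Y * killingForm ℂ 𝔤 X (tensorOp (t i) Z)
        + killingForm ℂ 𝔤 (x i) Z * killingForm ℂ 𝔤 X (tensorOp (t i) Y))
      + (killingForm ℂ 𝔤 X ⁅tensorOp r Y, tensorOp r Z⁆
        - killingForm ℂ 𝔤 Y ⁅tensorOp r X, tensorOp r Z⁆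
        + killingForm ℂ 𝔤 Z ⁅tensorOp r X, tensorOp r Y⁆) := by
    intro X Y Z
    simp only [map_add, map_sum, pair3_wedge3, cyb, pair3_bracket12_13, pair3_bracket12_23,
      pair3_bracket13_23, hr, map_neg, LinearMap.neg_apply, neg_lie, lie_neg, neg_neg]
    ring
  have key2 : ∀ X Y Z : 𝔤, pair3 X Y Z (bracket12_23 (casimir 𝔤) (casimir 𝔤)) =
      killingForm ℂ 𝔤 Y ⁅X, Z⁆ := by
    intro X Y Z
    rw [pair3_bracket12_23, tensorOp_casimir, tensorOp_comm_casimir]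
  constructor
  · intro h X Y Z
    rw [← key, h, key2]
  · intro h
    exact eq_of_pair3 fun X Y Z => by rw [key, key2, h]

theorem tensorOp_skew {r : 𝔤 ⊗[ℂ] 𝔤} (hr : TensorProduct.comm ℂ 𝔤 𝔤 r = - r) (X Y : 𝔤) :
    killingForm ℂ 𝔤 (tensorOp r X) Y = - killingForm ℂ 𝔤 X (tensorOp r Y) := by
  rw [← killing_tensorOp_comm, hr]; simp

end

section

open LieAlgebra LieAlgebra.IsKilling LieModule

variable {𝔤 : Type*} [LieRing 𝔤] [LieAlgebra ℂ 𝔤] [FiniteDimensional ℂ 𝔤] [IsKilling ℂ 𝔤]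
variable {H : LieSubalgebra ℂ 𝔤} [H.IsCartanSubalgebra] {E : Weight ℂ H 𝔤 → 𝔤}

/-! ### Characteristic spaces -/

theorem isPos_neg_iff (b : (rootSystem H).Base) {α : Weight ℂ H 𝔤} (hα : α ∈ H.root) :
    b.IsPos ⟨-α, neg_mem_root hα⟩ ↔ ¬ b.IsPos ⟨α, hα⟩ := by
  rw [← RootPairing.Base.IsPos.neg_iff_not]
  have : (⟨-α, neg_mem_root hα⟩ : H.root) =
      (rootSystem H).reflectionPerm ⟨α, hα⟩ ⟨α, hα⟩ := by
    refine (rootSystem H).root.injective ?_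
    rw [RootPairing.root_reflectionPerm, RootPairing.reflection_apply_self]
    rfl
  rw [this]
  rfl

theorem ne_neg_of_mem_root {α : Weight ℂ H 𝔤} (hα : α ∈ H.root) : α ≠ -α := by
  intro h
  refine root_ne_zero hα (funext fun z => ?_)
  have := congrArg (fun w : Weight ℂ H 𝔤 => w z) h
  simp only [Weight.coe_neg, Pi.neg_apply] at this
  simp only [Pi.zero_apply]
  linear_combination (1/2 : ℂ) * this

theorem tensorOp_standardR (b : (rootSystem H).Base) (X : 𝔤) :
    tensorOp (standardR H b E) X = ∑ α : H.root, open Classical in if b.IsPos α then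
      killingForm ℂ 𝔤 (E (-α.1)) X • E α.1 - killingForm ℂ 𝔤 (E α.1) X • E (-α.1) else 0 := by
  classical
  rw [standardR, map_sum, LinearMap.sum_apply]
  refine Finset.sum_congr rfl fun α _ => ?_
  split_ifs <;> simp

theorem IsRootVectors.standardR_pos (hE : IsRootVectors E) (b : (rootSystem H).Base)
    {α : H.root} (hα : b.IsPos α) : tensorOp (standardR H b E) (E α.1) = E α.1 := by
  classical
  rw [tensorOp_standardR, Finset.sum_eq_single α]
  · have h4 := hE.killing (neg_mem_root α.2) α.2
    rw [neg_neg, if_neg (ne_neg_of_mem_root α.2).symm] at h4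
    rw [if_pos hα, hE.killing α.2 α.2, h4]
    simp
  · intro β _ hne
    split_ifs with hβ
    · have h1 : β.1 ≠ α.1 := fun h => hne (Subtype.ext h)
      have h2 : -β.1 ≠ α.1 := by
        intro h
        have h3 := (isPos_neg_iff b β.2).1 (by
          have : (⟨-β.1, neg_mem_root β.2⟩ : H.root) = α := Subtype.ext h
          rwa [this])
        exact h3 hβ
      have h4 := hE.killing (neg_mem_root β.2) α.2
      rw [neg_neg, if_neg h2] at h4
      rw [hE.killing β.2 α.2, if_neg h1, h4]
      simp
    · rfl
  · simp

theorem IsRootVectors.standardR_neg (hE : IsRootVectors E) (b : (rootSystem H).Base)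
    {α : H.root} (hα : b.IsPos α) : tensorOp (standardR H b E) (E (-α.1)) = -E (-α.1) := by
  classical
  rw [tensorOp_standardR, Finset.sum_eq_single α]
  · rw [if_pos hα, hE.killing α.2 (neg_mem_root α.2), hE.pair _ α.2, if_neg (ne_neg_of_mem_root α.2)]
    simp
  · intro β _ hne
    split_ifs with hβ
    · have h1 : -β.1 ≠ -α.1 := fun h => hne (Subtype.ext (neg_injective h))
      have h2 : β.1 ≠ -α.1 := by
        intro h
        have h3 := (isPos_neg_iff b α.2).1 (by
          have : (⟨-α.1, neg_mem_root α.2⟩ : H.root) = β := Subtype.ext h.symm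
          rwa [this])
        exact h3 hα
      have h4 := hE.killing (neg_mem_root β.2) (neg_mem_root α.2)
      rw [neg_neg, if_neg h1] at h4
      rw [hE.killing β.2 (neg_mem_root α.2), if_neg h2, h4]
      simp
    · rfl
  · simp

theorem IsRootVectors.standardR_nPos (hE : IsRootVectors E) (b : (rootSystem H).Base)
    {X : 𝔤} (hX : X ∈ nPos H b) : tensorOp (standardR H b E) X = X := by
  have : nPos H b ≤ LinearMap.eqLocus (tensorOp (standardR H b E)) LinearMap.id := by
    refine iSup₂_le fun α hα X hX => ?_
    rw [LinearMap.mem_eqLocus, hE.eq_smul α.2 hX, map_smul, hE.standardR_pos b hα]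
    rfl
  exact this hX

theorem IsRootVectors.standardR_nNeg (hE : IsRootVectors E) (b : (rootSystem H).Base)
    {X : 𝔤} (hX : X ∈ nNeg H b) : tensorOp (standardR H b E) X = -X := by
  have : nNeg H b ≤ LinearMap.eqLocus (tensorOp (standardR H b E)) (-LinearMap.id) := by
    refine iSup₂_le fun α hα X hX => ?_
    rw [LinearMap.mem_eqLocus, hE.eq_smul (neg_mem_root α.2) hX, map_smul, hE.standardR_neg b hα]
    simp
  exact this hX

theorem IsRootVectors.nPos_orthogonal (hE : IsRootVectors E) (b : (rootSystem H).Base)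
    {X h : 𝔤} (hX : X ∈ nPos H b) (hh : h ∈ H) : killingForm ℂ 𝔤 X h = 0 := by
  have : nPos H b ≤ LinearMap.ker ((killingForm ℂ 𝔤).flip h) := by
    refine iSup₂_le fun α _ X hX => ?_
    rw [LinearMap.mem_ker, hE.eq_smul α.2 hX]
    simp [hE.killing_cartan α.2 hh]
  exact this hX

theorem IsRootVectors.nNeg_orthogonal (hE : IsRootVectors E) (b : (rootSystem H).Base)
    {X h : 𝔤} (hX : X ∈ nNeg H b) (hh : h ∈ H) : killingForm ℂ 𝔤 X h = 0 := by
  have : nNeg H b ≤ LinearMap.ker ((killingForm ℂ 𝔤).flip h) := by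
    refine iSup₂_le fun α _ X hX => ?_
    rw [LinearMap.mem_ker, hE.eq_smul (neg_mem_root α.2) hX]
    simp [hE.killing_cartan (neg_mem_root α.2) hh]
  exact this hX

theorem IsRootVectors.mem_nPos_sup_nNeg (hE : IsRootVectors E) (b : (rootSystem H).Base)
    {Y : 𝔤} (hY : ∀ h ∈ H, killingForm ℂ 𝔤 Y h = 0) : Y ∈ nPos H b ⊔ nNeg H b := by
  rw [hE.eq_sum_of_orthogonal hY]
  refine Submodule.sum_mem _ fun α hα => Submodule.smul_mem _ _ ?_
  by_cases h : b.IsPos ⟨α, hα⟩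
  · refine Submodule.mem_sup_left ?_
    exact Submodule.mem_iSup_of_mem ⟨α, hα⟩ (Submodule.mem_iSup_of_mem h (hE.mem _ hα))
  · refine Submodule.mem_sup_right ?_
    refine Submodule.mem_iSup_of_mem ⟨-α, neg_mem_root hα⟩
      (Submodule.mem_iSup_of_mem ((isPos_neg_iff b hα).2 h) ?_)
    simpa using hE.mem _ hα

/-- The subspace `{X + R Y - Y, X + R Y + Y}` of `𝔤 ⊕ 𝔤`, with `X ∈ 𝔥` and `Y ∈ 𝔥^⊥`. -/
def cayleySpace (H : LieSubalgebra ℂ 𝔤) (R : 𝔤 →ₗ[ℂ] 𝔤) : Set (𝔤 × 𝔤) :=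
  {z | ∃ X ∈ H, ∃ Y, (∀ h ∈ H, killingForm ℂ 𝔤 Y h = 0) ∧ z = (X + R Y - Y, X + R Y + Y)}

/-- For `ξ ∈ 𝔥^⊥` the `𝔥`-part of its representative vanishes, leaving `e = (Xm, Xp)` and `ξ = ⟨Y,
·⟩` with `Y = (Xp - Xm) / 2`. As `r₀` sends `Y` to `(Xp + Xm) / 2`, adding `e` to the diagonal
vector of `-r₀ Y` gives `(-Y, Y)`: the choice of positive roots drops out. -/
theorem IsRootVectors.characteristicSpace_eq (hE : IsRootVectors E) (b : (rootSystem H).Base)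
    (r : 𝔤 ⊗[ℂ] 𝔤) :
    characteristicSpace H b (r - standardR H b E) = cayleySpace H (tensorOp r) := by
  ext z
  constructor
  · rintro ⟨X, hX, ξ, hξ, e, ⟨⟨Xm, hm, Xp, hp, k, hk, rfl⟩, he⟩, rfl⟩
    have hk0 : k = 0 := by
      refine eq_zero_of_killing_cartan hk fun h hh => ?_
      have := he h
      rw [hξ h hh] at this
      simp only [doubleForm, map_sub, map_add, LinearMap.sub_apply, LinearMap.add_apply,
        hE.nPos_orthogonal b hp hh, hE.nNeg_orthogonal b hm hh] at this
      linear_combination -this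
    subst hk0
    have hξY : ξ = killingForm ℂ 𝔤 ((1 / 2 : ℂ) • (Xp - Xm)) := by
      ext Z
      rw [← he Z]
      simp [doubleForm]
    refine ⟨X, hX, (1 / 2 : ℂ) • (Xp - Xm), fun h hh => by rw [← hξY, hξ h hh], ?_⟩
    rw [hξY, sharp_killing, map_sub, LinearMap.sub_apply]
    have h0 : tensorOp (standardR H b E) ((1 / 2 : ℂ) • (Xp - Xm)) = (1 / 2 : ℂ) • (Xp + Xm) := by
      rw [map_smul, map_sub, hE.standardR_nPos b hp, hE.standardR_nNeg b hm, sub_neg_eq_add]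
    rw [h0]
    ext <;> simp only [Prod.fst_add, Prod.snd_add] <;> module
  · rintro ⟨X, hX, Y, hY, rfl⟩
    obtain ⟨Yp, hp, Ym, hm, rfl⟩ := Submodule.mem_sup.1 (hE.mem_nPos_sup_nNeg b hY)
    -- The representative of `⟨Y, ·⟩` inverts `Y = (Xp - Xm) / 2`, hence the factors `-2` and `2`.
    refine ⟨X, hX, killingForm ℂ 𝔤 (Yp + Ym), hY, ((-2 : ℂ) • Ym + 0, (2 : ℂ) • Yp - 0),
      ⟨⟨_, Submodule.smul_mem _ _ hm, _, Submodule.smul_mem _ _ hp, 0, H.zero_mem, rfl⟩, ?_⟩, ?_⟩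
    · intro Z
      simp [doubleForm]
      ring
    · have h0 : tensorOp (standardR H b E) (Yp + Ym) = Yp - Ym := by
        rw [map_add, hE.standardR_nPos b hp, hE.standardR_nNeg b hm, sub_eq_add_neg]
      rw [sharp_killing, map_sub, LinearMap.sub_apply, h0]
      ext <;> simp only [Prod.fst_add, Prod.snd_add] <;> module

end

section

open LieAlgebra LieAlgebra.IsKilling LieModule

variable {𝔤 : Type*} [LieRing 𝔤] [LieAlgebra ℂ 𝔤] [FiniteDimensional ℂ 𝔤] [IsKilling ℂ 𝔤]
variable {H : LieSubalgebra ℂ 𝔤} [H.IsCartanSubalgebra] {E : Weight ℂ H 𝔤 → 𝔤}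

/-! ### Lagrangian subalgebras of the double -/

variable (𝔤) in
/-- `doubleForm` as a bilinear form. -/
def doubleBilin : LinearMap.BilinForm ℂ (𝔤 × 𝔤) :=
  (1 / 2 : ℂ) • ((killingForm ℂ 𝔤).compl₁₂ (LinearMap.snd ℂ 𝔤 𝔤) (LinearMap.snd ℂ 𝔤 𝔤) -
    (killingForm ℂ 𝔤).compl₁₂ (LinearMap.fst ℂ 𝔤 𝔤) (LinearMap.fst ℂ 𝔤 𝔤))

theorem doubleBilin_apply (z w : 𝔤 × 𝔤) : doubleBilin 𝔤 z w = doubleForm z w := by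
  simp [doubleBilin, doubleForm]

theorem doubleForm_comm (z w : 𝔤 × 𝔤) : doubleForm z w = doubleForm w z := by
  simp [doubleForm, killing_comm z.1, killing_comm z.2]

theorem doubleBilin_isRefl : (doubleBilin 𝔤).IsRefl := by
  intro z w h
  rw [doubleBilin_apply] at h ⊢
  rw [doubleForm_comm, h]

theorem doubleBilin_nondegenerate : (doubleBilin 𝔤).Nondegenerate := by
  refine (LinearMap.IsRefl.nondegenerate_iff_separatingLeft
    (doubleBilin_isRefl (𝔤 := 𝔤))).2 fun z hz => ?_
  refine Prod.ext (eq_zero_of_killing fun Y => ?_) (eq_zero_of_killing fun Y => ?_)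
  · have := hz (Y, 0)
    rw [doubleBilin_apply] at this
    simpa [doubleForm] using this
  · have := hz (0, Y)
    rw [doubleBilin_apply] at this
    simpa [doubleForm] using this

/-- The form on the double is nondegenerate, so `W^⊥` has dimension `2 dim 𝔤 - dim 𝔤`; it contains
`W`, hence equals it. -/
theorem IsLagrangian.mem_of_orthogonal {W : LieSubalgebra ℂ (𝔤 × 𝔤)} (hW : IsLagrangian W)
    {z : 𝔤 × 𝔤} (hz : ∀ w ∈ W, doubleForm w z = 0) : z ∈ W := by
  have h1 : W.toSubmodule ≤ (doubleBilin 𝔤).orthogonal W.toSubmodule := by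
    intro w hw v hv
    exact (doubleBilin_apply v w).trans (hW.isotropic v hv w hw)
  have h2 := Submodule.eq_of_le_of_finrank_le h1 (by
    rw [LinearMap.BilinForm.finrank_orthogonal doubleBilin_nondegenerate, Module.finrank_prod]
    have := hW.finrank_eq
    change _ ≤ Module.finrank ℂ W
    have h3 : Module.finrank ℂ W.toSubmodule = Module.finrank ℂ 𝔤 := this
    omega)
  have h3 : z ∈ W.toSubmodule := by
    rw [h2]
    intro v hv
    exact (doubleBilin_apply v z).trans (hz v hv)
  exact h3

/-- `E α` is a difference of components of an element of `W`. -/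
theorem IsRootVectors.exists_sub_eq (hE : IsRootVectors E) {W : LieSubalgebra ℂ (𝔤 × 𝔤)}
    (hW : IsLagrangian W) (hWH : MeetsDiagonalIn H W) {α : Weight ℂ H 𝔤} (hα : α ∈ H.root) :
    ∃ z ∈ W, z.2 - z.1 = (2 : ℂ) • E α := by
  let D : Submodule ℂ 𝔤 := W.toSubmodule.map (LinearMap.snd ℂ 𝔤 𝔤 - LinearMap.fst ℂ 𝔤 𝔤)
  have hrefl : (killingForm ℂ 𝔤).IsRefl := fun X Y h => by rw [killing_comm, h]
  have hD : LinearMap.BilinForm.orthogonal (killingForm ℂ 𝔤)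
      (LinearMap.BilinForm.orthogonal (killingForm ℂ 𝔤) D) = D :=
    LinearMap.BilinForm.orthogonal_orthogonal (killingForm_nondegenerate ℂ 𝔤) hrefl D
  have hmem : (2 : ℂ) • E α ∈ D := by
    rw [← hD]
    intro X hX
    -- If `X` is orthogonal to all differences `w.2 - w.1`, then `(X, X)` is orthogonal to `W`,
    -- hence lies in `W`. Thus `D^⊥ ⊆ 𝔥`, and `E α`, being orthogonal to `𝔥`, lies in `D^⊥⊥ = D`.
    have hXH : X ∈ H := by
      refine (hWH X).1 (hW.mem_of_orthogonal fun w hw => ?_)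
      have : killingForm ℂ 𝔤 (w.2 - w.1) X = 0 := hX _ ⟨w, hw, rfl⟩
      rw [map_sub, LinearMap.sub_apply] at this
      simp [doubleForm, this]
    change killingForm ℂ 𝔤 X _ = 0
    rw [map_smul, killing_comm, hE.killing_cartan hα hXH, smul_zero]
  obtain ⟨z, hz, h⟩ := hmem
  exact ⟨z, hz, h⟩

/-- `W` contains the vectors `((φ α - 1) E α, (φ α + 1) E α)`. -/
def HasCayleyVectors (E : Weight ℂ H 𝔤 → 𝔤) (W : LieSubalgebra ℂ (𝔤 × 𝔤))
    (φ : Weight ℂ H 𝔤 → ℂ) : Prop :=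
  ∀ α ∈ H.root, ((φ α - 1) • E α, (φ α + 1) • E α) ∈ W

theorem IsRootVectors.exists_cayley (hE : IsRootVectors E) {W : LieSubalgebra ℂ (𝔤 × 𝔤)}
    (hW : IsLagrangian W) (hWH : MeetsDiagonalIn H W) : ∃ φ, HasCayleyVectors E W φ := by
  suffices h : ∀ α ∈ H.root, ∃ c : ℂ, ((c - 1) • E α, (c + 1) • E α) ∈ W by
    choose! φ hφ using h
    exact ⟨φ, hφ⟩
  classical
  intro α hα
  obtain ⟨⟨A, B⟩, hz, hAB⟩ := hE.exists_sub_eq hW hWH hα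
  have hB : B = A + (2 : ℂ) • E α := by
    rw [← hAB]; simp
  -- Applying `ad (h, h) - α h` kills the discrepancy `2 E α` between the two components. What
  -- remains is a diagonal element of `W`, so it lies in `𝔥`, while its `β`-coordinate is `β h - α
  -- h` times that of `A`.
  have hzero : ∀ β ∈ H.root, β ≠ α → killingForm ℂ 𝔤 (E (-β)) A = 0 := by
    intro β hβ hne
    obtain ⟨h, hh⟩ : ∃ h : H, β h ≠ α h := by
      by_contra! hcon
      exact hne (DFunLike.ext _ _ hcon)
    have h1 : ⁅((h : 𝔤), (h : 𝔤)), (A, B)⁆ - α h • (A, B) ∈ W :=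
      W.sub_mem (W.lie_mem ((hWH _).2 h.2) hz) (W.smul_mem _ hz)
    have h2 : ⁅((h : 𝔤), (h : 𝔤)), (A, B)⁆ - α h • (A, B) =
        (⁅(h : 𝔤), A⁆ - α h • A, ⁅(h : 𝔤), A⁆ - α h • A) := by
      ext
      · rfl
      · change ⁅(h : 𝔤), B⁆ - α h • B = _
        rw [hB, lie_add, lie_smul, hE.lie_cartan hα]
        module
    rw [h2] at h1
    have h3 := hE.killing_cartan (neg_mem_root hβ) ((hWH _).1 h1)
    have h4 : killingForm ℂ 𝔤 (E (-β)) ⁅(h : 𝔤), A⁆ = β h * killingForm ℂ 𝔤 (E (-β)) A := by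
      rw [← killing_lie, ← lie_skew, hE.lie_cartan (neg_mem_root hβ)]
      simp
    rw [map_sub, h4, map_smul, smul_eq_mul, ← sub_mul] at h3
    exact (mul_eq_zero.1 h3).resolve_left (sub_ne_zero.2 hh)
  obtain ⟨k, hk, hA⟩ := hE.eq_cartan_add A
  rw [Finset.sum_eq_single α (fun β hβ hne => by rw [hzero β hβ hne, zero_smul])
    (fun h => (h hα).elim)] at hA
  set a := killingForm ℂ 𝔤 (E (-α)) A
  -- Subtracting `(k, k)` leaves `(a E α, (a + 2) E α)`, so `c - 1 = a`.
  refine ⟨a + 1, ?_⟩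
  have h5 := W.sub_mem hz ((hWH k).2 hk)
  convert h5 using 1
  ext
  · change _ = A - k
    rw [hA]; module
  · change _ = B - k
    rw [hB, hA]; module

theorem HasCayleyVectors.neg (hE : IsRootVectors E) {W : LieSubalgebra ℂ (𝔤 × 𝔤)}
    (hW : IsLagrangian W) {φ : Weight ℂ H 𝔤 → ℂ} (hφ : HasCayleyVectors E W φ)
    {α : Weight ℂ H 𝔤} (hα : α ∈ H.root) : φ (-α) = - φ α := by
  have h := hW.isotropic _ (hφ α hα) _ (hφ (-α) (neg_mem_root hα))
  simp [doubleForm, hE.pair α hα] at h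
  linear_combination (1 / 2 : ℂ) * h

/-- Isotropy pairs the bracket of two Cayley vectors with a third; half the difference of the
products of the `φ + 1` and of the `φ - 1` is the quadratic factor. -/
theorem HasCayleyVectors.triple {W : LieSubalgebra ℂ (𝔤 × 𝔤)}
    (hW : IsLagrangian W) {φ : Weight ℂ H 𝔤 → ℂ} (hφ : HasCayleyVectors E W φ)
    {α β γ : Weight ℂ H 𝔤} (hα : α ∈ H.root) (hβ : β ∈ H.root) (hγ : γ ∈ H.root) :
    (φ α * φ β + φ β * φ γ + φ γ * φ α + 1) * killingForm ℂ 𝔤 ⁅E α, E β⁆ (E γ) = 0 := by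
  have h := hW.isotropic _ (W.lie_mem (hφ α hα) (hφ β hβ)) _ (hφ γ hγ)
  simp only [doubleForm, LieAlgebra.Prod.bracket_apply, lie_smul, smul_lie, map_smul,
    LinearMap.smul_apply, smul_eq_mul] at h
  linear_combination h

theorem HasCayleyVectors.cayleySpace_subset (hE : IsRootVectors E)
    {W : LieSubalgebra ℂ (𝔤 × 𝔤)} (hWH : ∀ h ∈ H, (h, h) ∈ W)
    {φ : Weight ℂ H 𝔤 → ℂ} (hφ : HasCayleyVectors E W φ) {R : 𝔤 →ₗ[ℂ] 𝔤}
    (hR : ∀ α ∈ H.root, R (E α) = φ α • E α) : cayleySpace H R ⊆ W := by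
  rintro _ ⟨X, hX, Y, hY, rfl⟩
  rw [hE.eq_sum_of_orthogonal hY]
  have : (X + R (∑ α ∈ H.root, killingForm ℂ 𝔤 (E (-α)) Y • E α)
        - ∑ α ∈ H.root, killingForm ℂ 𝔤 (E (-α)) Y • E α,
      X + R (∑ α ∈ H.root, killingForm ℂ 𝔤 (E (-α)) Y • E α)
        + ∑ α ∈ H.root, killingForm ℂ 𝔤 (E (-α)) Y • E α) =
      (X, X) + ∑ α ∈ H.root, killingForm ℂ 𝔤 (E (-α)) Y •
        ((φ α - 1) • E α, (φ α + 1) • E α) := by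
    ext
    · simp only [map_sum, map_smul, Prod.fst_add, Prod.fst_sum, Prod.smul_fst]
      rw [add_sub_assoc, ← Finset.sum_sub_distrib]
      congr 1
      refine Finset.sum_congr rfl fun α hα => ?_
      rw [hR α hα]; module
    · simp only [map_sum, map_smul, Prod.snd_add, Prod.snd_sum, Prod.smul_snd]
      rw [add_assoc, ← Finset.sum_add_distrib]
      congr 1
      refine Finset.sum_congr rfl fun α hα => ?_
      rw [hR α hα]; module
  rw [this]
  refine W.add_mem (hWH X hX) ?_
  exact W.toSubmodule.sum_mem fun α hα => W.smul_mem _ (hφ α hα)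

/-- A Lagrangian subalgebra that contains the diagonal `𝔥` is determined by its Cayley
vectors. -/
theorem HasCayleyVectors.eq_cayleySpace (hE : IsRootVectors E)
    {W : LieSubalgebra ℂ (𝔤 × 𝔤)} (hW : IsLagrangian W) (hWH : ∀ h ∈ H, (h, h) ∈ W)
    {φ : Weight ℂ H 𝔤 → ℂ} (hφ : HasCayleyVectors E W φ) {R : 𝔤 →ₗ[ℂ] 𝔤}
    (hR : ∀ α ∈ H.root, R (E α) = φ α • E α) : (W : Set (𝔤 × 𝔤)) = cayleySpace H R := by
  refine subset_antisymm (fun z hz => ?_) (hφ.cayleySpace_subset hE hWH hR)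
  have hsub := hφ.cayleySpace_subset hE hWH hR
  let Y : 𝔤 := (1 / 2 : ℂ) • (z.2 - z.1)
  have hY : ∀ h ∈ H, killingForm ℂ 𝔤 Y h = 0 := by
    intro h hh
    have := hW.isotropic z hz (h, h) (hWH h hh)
    simpa [doubleForm, Y] using this
  have h1 : (0 + R Y - Y, 0 + R Y + Y) ∈ W := hsub ⟨0, H.zero_mem, Y, hY, rfl⟩
  have h2 := W.sub_mem hz h1
  let X : 𝔤 := z.1 - R Y + Y
  have h3 : z - (0 + R Y - Y, 0 + R Y + Y) = (X, X) := by
    ext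
    · simp only [Prod.fst_sub, X]; module
    · simp only [Prod.snd_sub, X, Y]; module
  rw [h3] at h2
  -- Pairing `(X, X)` with the Cayley vector of `-α` gives `⟨E (-α), X⟩`, whatever `φ` is, because
  -- `(φ + 1) - (φ - 1) = 2`.
  have hXH : X ∈ H := by
    refine hE.mem_cartan_of_killing fun α hα => ?_
    have h4 := hW.isotropic _ (hφ (-α) (neg_mem_root hα)) _ h2
    simp only [doubleForm, map_smul, LinearMap.smul_apply, smul_eq_mul] at h4
    linear_combination h4
  refine ⟨X, hXH, Y, hY, ?_⟩
  ext
  · simp only [X]; module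
  · simp only [X, Y]; module

theorem IsLagrangian.eq_of_le {W W' : LieSubalgebra ℂ (𝔤 × 𝔤)} (hW : IsLagrangian W)
    (hW' : IsLagrangian W') (h : ∀ z ∈ W, z ∈ W') : W = W' := by
  have h1 : W.toSubmodule = W'.toSubmodule := Submodule.eq_of_le_of_finrank_le h
    (le_of_eq ((hW'.finrank_eq).trans hW.finrank_eq.symm))
  exact SetLike.ext fun z => by
    rw [← LieSubalgebra.mem_toSubmodule, h1, LieSubalgebra.mem_toSubmodule]

/-! ### The twisting automorphisms -/

/-- The automorphism `exp (ad h)` for `h` in the Cartan subalgebra. -/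
def cartanExp (E : Weight ℂ H 𝔤 → 𝔤) (h : H) : 𝔤 →ₗ[ℂ] 𝔤 :=
  LinearMap.id + rootOp E (fun α => Complex.exp (α h) - 1)

/-- Allowing any function `χ`, weight or not, lets multiplicativity be checked on sums `χ + ψ`
without a case split: if `χ` is not a weight, then `X = 0`. -/
theorem IsRootVectors.cartanExp_of_mem (hE : IsRootVectors E) (h : H) {χ : H → ℂ} {X : 𝔤}
    (hX : X ∈ rootSpace H χ) : cartanExp E h X = Complex.exp (χ h) • X := by
  by_cases h0 : X = 0
  · simp [h0]
  have hne : rootSpace H χ ≠ ⊥ := fun hb => h0 (by rw [hb] at hX; simpa using hX)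
  let w : Weight ℂ H 𝔤 := ⟨χ, hne⟩
  by_cases hw : w ∈ H.root
  · rw [hE.eq_smul hw hX, map_smul]
    change _ • (E w + rootOp E _ (E w)) = _
    rw [hE.rootOp_root _ hw]
    change _ • (E w + (Complex.exp (χ h) - 1) • E w) = _
    module
  · have hχ : χ = 0 := by
      have : w.IsZero := by simpa using hw
      exact this
    subst hχ
    change X + rootOp E _ X = _
    rw [hE.rootOp_cartan _ (mem_rootSpace_zero.1 hX)]
    simp

theorem rootSpace_induction {p : 𝔤 → Prop} (mem : ∀ (χ : H → ℂ), ∀ X ∈ rootSpace H χ, p X)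
    (zero : p 0) (add : ∀ X Y, p X → p Y → p (X + Y)) (X : 𝔤) : p X := by
  have hX : X ∈ ⨆ χ : H → ℂ, rootSpace H χ := by
    rw [iSup_genWeightSpace_eq_top ℂ H 𝔤]; trivial
  induction hX using LieSubmodule.iSup_induction' with
  | mem χ X hX => exact mem χ X hX
  | zero => exact zero
  | add X Y _ _ hX hY => exact add X Y hX hY

theorem IsRootVectors.cartanExp_lie (hE : IsRootVectors E) (h : H) (X Y : 𝔤) :
    cartanExp E h ⁅X, Y⁆ = ⁅cartanExp E h X, cartanExp E h Y⁆ := by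
  induction X using rootSpace_induction (H := H) with
  | zero => simp
  | add X X' hX hX' => simp [hX, hX']
  | mem χ X hX =>
    induction Y using rootSpace_induction (H := H) with
    | zero => simp
    | add Y Y' hY hY' => simp [hY, hY']
    | mem ψ Y hY =>
      rw [hE.cartanExp_of_mem h hX, hE.cartanExp_of_mem h hY,
        hE.cartanExp_of_mem h (lie_mem_genWeightSpace_of_mem_genWeightSpace hX hY),
        smul_lie, lie_smul, smul_smul, Pi.add_apply, Complex.exp_add]

theorem IsRootVectors.cartanExp_add (hE : IsRootVectors E) (h k : H) (X : 𝔤) :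
    cartanExp E (h + k) X = cartanExp E h (cartanExp E k X) := by
  have : cartanExp E (h + k) = cartanExp E h ∘ₗ cartanExp E k := by
    refine hE.linearMap_ext (fun X hX => ?_) (fun α hα => ?_)
    · have hX := mem_rootSpace_zero.2 hX
      simp [hE.cartanExp_of_mem _ hX]
    · have hα := hE.mem α hα
      simp only [LinearMap.comp_apply, hE.cartanExp_of_mem _ hα, map_smul, smul_smul,
        ← Complex.exp_add]
      congr 2
      rw [← Weight.toLinear_apply, map_add, add_comm]; rfl
  rw [this]; rfl

theorem IsRootVectors.cartanExp_root (hE : IsRootVectors E) (h : H) {α : Weight ℂ H 𝔤}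
    (hα : α ∈ H.root) : cartanExp E h (E α) = Complex.exp (α h) • E α :=
  hE.cartanExp_of_mem h (hE.mem α hα)

theorem IsRootVectors.cartanExp_cartan (hE : IsRootVectors E) (h : H) {X : 𝔤}
    (hX : X ∈ H) : cartanExp E h X = X := by
  rw [hE.cartanExp_of_mem h (mem_rootSpace_zero.2 hX)]; simp

theorem IsRootVectors.cartanExp_zero (hE : IsRootVectors E) (X : 𝔤) :
    cartanExp E (0 : H) X = X := by
  have : cartanExp E (0 : H) = LinearMap.id := by
    refine hE.linearMap_ext (fun X hX => ?_) (fun α hα => ?_)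
    · simp [hE.cartanExp_cartan _ hX]
    · rw [hE.cartanExp_root _ hα]
      have : α (0 : H) = 0 := by rw [← Weight.toLinear_apply, map_zero]
      simp [this]
  rw [this]; rfl

/-- `cartanExp` as an automorphism of Lie algebras. -/
def cartanExpEquiv (hE : IsRootVectors E) (h : H) : 𝔤 ≃ₗ⁅ℂ⁆ 𝔤 where
  toLinearMap := cartanExp E h
  map_lie' := hE.cartanExp_lie h _ _
  invFun := cartanExp E (-h)
  left_inv X := by
    change cartanExp E (-h) (cartanExp E h X) = X
    rw [← hE.cartanExp_add, neg_add_cancel, hE.cartanExp_zero]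
  right_inv X := by
    change cartanExp E h (cartanExp E (-h) X) = X
    rw [← hE.cartanExp_add, add_neg_cancel, hE.cartanExp_zero]

/-- Every Lie algebra automorphism preserves the Killing form. -/
theorem IsRootVectors.killing_cartanExp (hE : IsRootVectors E) (h : H) (X Y : 𝔤) :
    killingForm ℂ 𝔤 (cartanExp E h X) (cartanExp E h Y) = killingForm ℂ 𝔤 X Y :=
  killingForm_of_equiv_apply (cartanExpEquiv hE h) X Y

/-- The automorphism `(exp (-ad h), exp (ad h))` of the double. -/
def twist (hE : IsRootVectors E) (h : H) : 𝔤 × 𝔤 →ₗ⁅ℂ⁆ 𝔤 × 𝔤 :=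
  LieHom.prodMap (cartanExpEquiv hE (-h)).toLieHom (cartanExpEquiv hE h).toLieHom

theorem twist_apply (hE : IsRootVectors E) (h : H) (z : 𝔤 × 𝔤) :
    twist hE h z = (cartanExp E (-h) z.1, cartanExp E h z.2) := rfl

theorem twist_add (hE : IsRootVectors E) (h k : H) (z : 𝔤 × 𝔤) :
    twist hE (h + k) z = twist hE h (twist hE k z) := by
  simp only [twist_apply, neg_add, hE.cartanExp_add]

theorem twist_zero (hE : IsRootVectors E) (z : 𝔤 × 𝔤) : twist hE (0 : H) z = z := by
  simp only [twist_apply, neg_zero, hE.cartanExp_zero]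

theorem twist_neg_twist (hE : IsRootVectors E) (h : H) (z : 𝔤 × 𝔤) :
    twist hE (-h) (twist hE h z) = z := by
  rw [← twist_add, neg_add_cancel, twist_zero]

theorem twist_twist_neg (hE : IsRootVectors E) (h : H) (z : 𝔤 × 𝔤) :
    twist hE h (twist hE (-h) z) = z := by
  rw [← twist_add, add_neg_cancel, twist_zero]

theorem doubleForm_twist (hE : IsRootVectors E) (h : H) (z w : 𝔤 × 𝔤) :
    doubleForm (twist hE h z) (twist hE h w) = doubleForm z w := by
  simp only [doubleForm, twist_apply, hE.killing_cartanExp]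

theorem twist_cartan (hE : IsRootVectors E) (h : H) {X : 𝔤} (hX : X ∈ H) :
    twist hE h (X, X) = (X, X) := by
  simp only [twist_apply, hE.cartanExp_cartan _ hX]

theorem twist_root (hE : IsRootVectors E) (h : H) {α : Weight ℂ H 𝔤} (hα : α ∈ H.root)
    (s t : ℂ) : twist hE h (s • E α, t • E α) =
      ((Complex.exp (-α h) * s) • E α, (Complex.exp (α h) * t) • E α) := by
  have : α (-h) = -α h := by rw [← Weight.toLinear_apply, map_neg]; rfl
  simp only [twist_apply, map_smul, hE.cartanExp_root _ hα, this, smul_smul, mul_comm]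

theorem mem_map_twist (hE : IsRootVectors E) (h : H) {W : LieSubalgebra ℂ (𝔤 × 𝔤)}
    {z : 𝔤 × 𝔤} : z ∈ W.map (twist hE h) ↔ twist hE (-h) z ∈ W := by
  rw [LieSubalgebra.mem_map]
  constructor
  · rintro ⟨w, hw, rfl⟩
    rwa [twist_neg_twist]
  · intro hz
    exact ⟨_, hz, twist_twist_neg hE h z⟩

theorem twist_injective (hE : IsRootVectors E) (h : H) : Function.Injective (twist hE h) :=
  Function.LeftInverse.injective (twist_neg_twist hE h)

theorem IsLagrangian.map_twist (hE : IsRootVectors E) (h : H) {W : LieSubalgebra ℂ (𝔤 × 𝔤)}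
    (hW : IsLagrangian W) : IsLagrangian (W.map (twist hE h)) where
  isotropic z hz w hw := by
    rw [mem_map_twist] at hz hw
    rw [← doubleForm_twist hE (-h)]
    exact hW.isotropic _ hz _ hw
  finrank_eq := by
    rw [← hW.finrank_eq]
    exact (Submodule.equivMapOfInjective (twist hE h : 𝔤 × 𝔤 →ₗ[ℂ] 𝔤 × 𝔤)
      (twist_injective hE h) W.toSubmodule).finrank_eq.symm

end

section

open LieAlgebra LieAlgebra.IsKilling LieModule

variable {𝔤 : Type*} [LieRing 𝔤] [LieAlgebra ℂ 𝔤] [FiniteDimensional ℂ 𝔤] [IsKilling ℂ 𝔤]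
variable {H : LieSubalgebra ℂ 𝔤} [H.IsCartanSubalgebra] {E : Weight ℂ H 𝔤 → 𝔤}

/-! ### Tensors that are diagonal in root vectors -/

/-- The tensor `∑ φ α • E α ⊗ E (-α)`. -/
def rootTensor (E : Weight ℂ H 𝔤 → 𝔤) (φ : Weight ℂ H 𝔤 → ℂ) : 𝔤 ⊗[ℂ] 𝔤 :=
  ∑ α ∈ H.root, φ α • (E α ⊗ₜ[ℂ] E (-α))

theorem tensorOp_rootTensor (φ : Weight ℂ H 𝔤 → ℂ) :
    tensorOp (rootTensor E φ) = rootOp E φ := by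
  ext X
  rw [rootOp_apply, rootTensor, map_sum, LinearMap.sum_apply]
  exact Finset.sum_congr rfl fun α _ => by simp [mul_smul]

theorem comm_rootTensor {φ : Weight ℂ H 𝔤 → ℂ} (hφ : ∀ α ∈ H.root, φ (-α) = - φ α) :
    TensorProduct.comm ℂ 𝔤 𝔤 (rootTensor E φ) = - rootTensor E φ := by
  rw [rootTensor, map_sum, ← Finset.sum_neg_distrib]
  refine Finset.sum_nbij' (fun α => -α) (fun α => -α) (fun α hα => neg_mem_root hα)
    (fun α hα => neg_mem_root hα) (fun α _ => neg_neg α) (fun α _ => neg_neg α) fun α hα => ?_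
  simp [hφ α hα]

theorem IsRootVectors.lie_rootTensor (hE : IsRootVectors E) (φ : Weight ℂ H 𝔤 → ℂ) {h : 𝔤}
    (hh : h ∈ H) : ⁅h, rootTensor E φ⁆ = 0 := by
  rw [rootTensor, lie_sum]
  refine Finset.sum_eq_zero fun α hα => ?_
  have h1 := hE.lie_cartan hα ⟨h, hh⟩
  have h2 := hE.lie_cartan (neg_mem_root hα) ⟨h, hh⟩
  simp only [Weight.coe_neg, Pi.neg_apply] at h1 h2
  rw [lie_smul, TensorProduct.LieModule.lie_tmul_right, h1, h2]
  rw [neg_smul, TensorProduct.tmul_neg, TensorProduct.tmul_smul, TensorProduct.smul_tmul']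
  simp

theorem pair3_add_left (X X' Y Z : 𝔤) : pair3 (X + X') Y Z = pair3 X Y Z + pair3 X' Y Z := by
  ext a b c; simp; ring

theorem pair3_smul_left (c : ℂ) (X Y Z : 𝔤) : pair3 (c • X) Y Z = c • pair3 X Y Z := by
  ext a b c; simp; ring

theorem pair3_add_mid (X Y Y' Z : 𝔤) : pair3 X (Y + Y') Z = pair3 X Y Z + pair3 X Y' Z := by
  ext a b c; simp; ring

theorem pair3_smul_mid (c : ℂ) (X Y Z : 𝔤) : pair3 X (c • Y) Z = c • pair3 X Y Z := by
  ext a b c; simp; ring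

theorem pair3_add_right (X Y Z Z' : 𝔤) : pair3 X Y (Z + Z') = pair3 X Y Z + pair3 X Y Z' := by
  ext a b c; simp; ring

theorem pair3_smul_right (c : ℂ) (X Y Z : 𝔤) : pair3 X Y (c • Z) = c • pair3 X Y Z := by
  ext a b c; simp; ring

/-- The vectors of `𝔥` together with the root vectors. -/
def cartanGenerators (E : Weight ℂ H 𝔤 → 𝔤) : Set 𝔤 := {X | X ∈ H ∨ ∃ α ∈ H.root, X = E α}

theorem IsRootVectors.span_cartanGenerators (hE : IsRootVectors E) :
    Submodule.span ℂ (cartanGenerators E) = ⊤ := by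
  refine Submodule.eq_top_iff'.2 fun X => ?_
  obtain ⟨h, hh, hX⟩ := hE.eq_cartan_add X
  rw [hX]
  refine Submodule.add_mem _ (Submodule.subset_span (Or.inl hh)) (Submodule.sum_mem _ fun α hα =>
    Submodule.smul_mem _ _ (Submodule.subset_span (Or.inr ⟨α, hα, rfl⟩)))

theorem IsRootVectors.eq_of_pair3 (hE : IsRootVectors E) {S T : 𝔤 ⊗[ℂ] (𝔤 ⊗[ℂ] 𝔤)}
    (h : ∀ X ∈ cartanGenerators E, ∀ Y ∈ cartanGenerators E, ∀ Z ∈ cartanGenerators E,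
      pair3 X Y Z S = pair3 X Y Z T) : S = T := by
  have hmem : ∀ X : 𝔤, X ∈ Submodule.span ℂ (cartanGenerators E) := fun X => by
    rw [hE.span_cartanGenerators]; trivial
  refine DynamicalR.eq_of_pair3 fun X Y Z => ?_
  induction hmem X using Submodule.span_induction with
  | zero => simp [pair3]
  | add X X' _ _ hX hX' => simp only [pair3_add_left, LinearMap.add_apply, hX, hX']
  | smul c X _ hX => simp only [pair3_smul_left, LinearMap.smul_apply, hX]
  | mem X hX =>
    induction hmem Y using Submodule.span_induction with
    | zero => simp [pair3]
    | add Y Y' _ _ hY hY' => simp only [pair3_add_mid, LinearMap.add_apply, hY, hY']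
    | smul c Y _ hY => simp only [pair3_smul_mid, LinearMap.smul_apply, hY]
    | mem Y hY =>
      induction hmem Z using Submodule.span_induction with
      | zero => simp [pair3]
      | add Z Z' _ _ hZ hZ' => simp only [pair3_add_right, LinearMap.add_apply, hZ, hZ']
      | smul c Z _ hZ => simp only [pair3_smul_right, LinearMap.smul_apply, hZ]
      | mem Z hZ => exact h X hX Y hY Z hZ

/-- The coordinates of `α ∈ 𝔥* ≅ 𝔥` in the basis `x`. -/
def dualCoord {n : ℕ} (x : Module.Basis (Fin n) ℂ H) (α : Weight ℂ H 𝔤) (i : Fin n) : ℂ :=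
  x.repr ((cartanEquivDual H).symm (Weight.toLinear ℂ H 𝔤 α)) i

theorem sum_killing_mul_dualCoord {n : ℕ} (x : Module.Basis (Fin n) ℂ H) (α : Weight ℂ H 𝔤)
    (h : H) : ∑ i, killingForm ℂ 𝔤 (x i : 𝔤) h * dualCoord x α i = α h := by
  rw [← Weight.toLinear_apply, ← killing_cartanEquivDual_symm]
  unfold dualCoord
  generalize (cartanEquivDual H).symm (Weight.toLinear ℂ H 𝔤 α) = t
  have h1 : (t : 𝔤) = ∑ i, x.repr t i • (x i : 𝔤) := by
    conv_lhs => rw [← x.sum_repr t]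
    rw [AddSubmonoidClass.coe_finsetSum]
    rfl
  rw [h1, map_sum, LinearMap.sum_apply]
  exact Finset.sum_congr rfl fun i _ => by simp [mul_comm]

/-- The derivatives are replaced by the values that the Riccati equation prescribes, which turns the
dynamical equation into an algebraic identity, checked on elements of `𝔥` and root vectors. -/
theorem IsRootVectors.cdybe_rootTensor (hE : IsRootVectors E) {n : ℕ}
    (x : Module.Basis (Fin n) ℂ H) {φ : Weight ℂ H 𝔤 → ℂ}
    (hneg : ∀ α ∈ H.root, φ (-α) = - φ α)
    (htriple : ∀ α ∈ H.root, ∀ β ∈ H.root, ∀ γ ∈ H.root,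
      (φ α * φ β + φ β * φ γ + φ γ * φ α + 1) * killingForm ℂ 𝔤 ⁅E α, E β⁆ (E γ) = 0) :
    ∑ i, wedge3 (x i : 𝔤) (rootTensor E fun α => (1 - φ α ^ 2) * dualCoord x α i)
      + cyb (rootTensor E φ) = bracket12_23 (casimir 𝔤) (casimir 𝔤) := by
  classical
  have hskew := comm_rootTensor (E := E) hneg
  -- The case of exactly one argument in `𝔥`. Both sides vanish unless `γ = -β`, and then `-(1 - φ²)
  -- β(h) - φ² β(h) = -β(h)`.
  have aux : ∀ (h : 𝔤) (_ : h ∈ H) (β γ : Weight ℂ H 𝔤) (_ : β ∈ H.root) (_ : γ ∈ H.root),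
      ∑ i, killingForm ℂ 𝔤 (x i : 𝔤) h *
          ((1 - φ γ ^ 2) * dualCoord x γ i * killingForm ℂ 𝔤 (E β) (E γ))
        + φ β * (φ γ * killingForm ℂ 𝔤 h ⁅E β, E γ⁆) = - killingForm ℂ 𝔤 h ⁅E β, E γ⁆ := by
    intro h hh β γ hβ hγ
    have h1 : ∑ i, killingForm ℂ 𝔤 (x i : 𝔤) h *
        ((1 - φ γ ^ 2) * dualCoord x γ i * killingForm ℂ 𝔤 (E β) (E γ)) =
        (1 - φ γ ^ 2) * killingForm ℂ 𝔤 (E β) (E γ) * γ ⟨h, hh⟩ := by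
      rw [← sum_killing_mul_dualCoord x γ ⟨h, hh⟩, Finset.mul_sum]
      exact Finset.sum_congr rfl fun i _ => by ring
    have h2 : killingForm ℂ 𝔤 h ⁅E β, E γ⁆ = β ⟨h, hh⟩ * killingForm ℂ 𝔤 (E β) (E γ) := by
      have := hE.lie_cartan hβ ⟨h, hh⟩
      simp only at this
      rw [← killing_lie, this]
      simp
    rw [h1, h2]
    have h3 := hE.killing (neg_mem_root hβ) hγ
    rw [neg_neg] at h3
    by_cases hβγ : -β = γ
    · subst hβγ
      rw [hneg β hβ]
      simp only [Weight.coe_neg, Pi.neg_apply]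
      ring
    · rw [if_neg hβγ] at h3
      rw [h3]
      ring
  refine hE.eq_of_pair3 fun X hX Y hY Z hZ => ?_
  rw [pair3_bracket12_23, tensorOp_casimir, tensorOp_comm_casimir]
  simp only [map_add, map_sum, pair3_wedge3, cyb, pair3_bracket12_13, pair3_bracket12_23,
      pair3_bracket13_23, hskew, map_neg, LinearMap.neg_apply, neg_lie, lie_neg, neg_neg,
      tensorOp_rootTensor]
  have hEr : ∀ (c : Weight ℂ H 𝔤 → ℂ) (α : Weight ℂ H 𝔤), α ∈ H.root →
      rootOp E c (E α) = c α • E α := fun c α hα => hE.rootOp_root c hα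
  have hxE : ∀ (i : Fin n) (α : Weight ℂ H 𝔤), α ∈ H.root →
      killingForm ℂ 𝔤 (x i : 𝔤) (E α) = 0 := fun i α hα => by
    rw [killing_comm, hE.killing_cartan hα (x i).2]
  -- With two or three arguments in `𝔥` every term vanishes; with one, `aux` applies up to the order
  -- of the arguments; with none, the derivative terms vanish and the relation on triples remains.
  rcases hX with hX | ⟨α, hα, rfl⟩ <;> rcases hY with hY | ⟨β, hβ, rfl⟩ <;>
    rcases hZ with hZ | ⟨γ, hγ, rfl⟩
  · simp only [hE.rootOp_cartan _ hX, hE.rootOp_cartan _ hY, hE.rootOp_cartan _ hZ,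
      lie_cartan_cartan hX hZ]
    simp
  · have h1 := hE.lie_cartan hγ ⟨X, hX⟩
    simp only at h1
    simp only [hE.rootOp_cartan _ hX, hE.rootOp_cartan _ hY, hEr _ _ hγ, h1, map_smul,
      killing_comm _ (E γ), hE.killing_cartan hγ hX, hE.killing_cartan hγ hY]
    simp
  · have h1 : killingForm ℂ 𝔤 (E β) ⁅X, Z⁆ = 0 := by rw [lie_cartan_cartan hX hZ, map_zero]
    simp only [hE.rootOp_cartan _ hX, hE.rootOp_cartan _ hZ, hEr _ _ hβ, h1, map_smul,
      killing_comm _ (E β), hE.killing_cartan hβ hX]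
    simp
  · simp only [hE.rootOp_cartan _ hX, hEr _ _ hβ, hEr _ _ hγ, hxE _ _ hβ, hxE _ _ hγ, map_smul,
      smul_lie, lie_smul, zero_lie, map_zero, smul_eq_mul, zero_mul, sub_zero, add_zero]
    have h1 : killingForm ℂ 𝔤 (E β) ⁅X, E γ⁆ = - killingForm ℂ 𝔤 X ⁅E β, E γ⁆ := by
      rw [← killing_lie, ← killing_lie, ← lie_skew, map_neg, LinearMap.neg_apply]
    linear_combination aux X hX β γ hβ hγ - h1
  · have h1 : killingForm ℂ 𝔤 Y ⁅E α, Z⁆ = 0 := by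
      rw [killing_comm, killing_lie, lie_cartan_cartan hZ hY, map_zero]
    simp only [hE.rootOp_cartan _ hY, hE.rootOp_cartan _ hZ, hEr _ _ hα, h1]
    simp
  · simp only [hE.rootOp_cartan _ hY, hEr _ _ hα, hEr _ _ hγ, hxE _ _ hα, hxE _ _ hγ, map_smul,
      smul_lie, lie_smul, lie_zero, zero_lie, map_zero, smul_eq_mul, zero_mul, add_zero, zero_sub,
      Finset.sum_neg_distrib]
    linear_combination -aux Y hY α γ hα hγ
  · simp only [hE.rootOp_cartan _ hZ, hEr _ _ hα, hEr _ _ hβ, hxE _ _ hα, hxE _ _ hβ, map_smul,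
      smul_lie, lie_smul, lie_zero, map_zero, smul_eq_mul, zero_mul, add_zero, zero_add,
      sub_self, neg_zero]
    have h1 : killingForm ℂ 𝔤 (E β) ⁅E α, Z⁆ = - killingForm ℂ 𝔤 Z ⁅E α, E β⁆ := by
      rw [← killing_lie, ← lie_skew, map_neg, LinearMap.neg_apply, killing_comm]
    linear_combination aux Z hZ α β hα hβ - h1
  · simp only [hEr _ _ hα, hEr _ _ hβ, hEr _ _ hγ, hxE _ _ hα, hxE _ _ hβ, hxE _ _ hγ, map_smul,
      smul_lie, lie_smul, smul_eq_mul, zero_mul, add_zero, sub_self, Finset.sum_const_zero,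
      zero_add]
    have h1 : killingForm ℂ 𝔤 (E α) ⁅E β, E γ⁆ = killingForm ℂ 𝔤 ⁅E α, E β⁆ (E γ) :=
      (killing_lie _ _ _).symm
    have h2 : killingForm ℂ 𝔤 (E β) ⁅E α, E γ⁆ = - killingForm ℂ 𝔤 ⁅E α, E β⁆ (E γ) := by
      rw [← killing_lie, ← lie_skew, map_neg, LinearMap.neg_apply]
    have h3 : killingForm ℂ 𝔤 (E γ) ⁅E α, E β⁆ = killingForm ℂ 𝔤 ⁅E α, E β⁆ (E γ) :=
      killing_comm _ _
    rw [h1, h2, h3]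
    linear_combination htriple α hα β hβ γ hγ

/-! ### Consequences of the dynamical Yang-Baxter equation -/

/-- A tensor of weight zero acts on root vectors by scalars. -/
theorem IsRootVectors.tensorOp_root (hE : IsRootVectors E) {r : 𝔤 ⊗[ℂ] 𝔤}
    (hr : ∀ h ∈ H, ⁅h, r⁆ = 0) {α : Weight ℂ H 𝔤} (hα : α ∈ H.root) :
    tensorOp r (E α) = killingForm ℂ 𝔤 (E (-α)) (tensorOp r (E α)) • E α := by
  classical
  have hcomm : ∀ h : H, ⁅(h : 𝔤), tensorOp r (E α)⁆ = α h • tensorOp r (E α) := by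
    intro h
    have h1 := tensorOp_lie (h : 𝔤) r (E α)
    rw [hr h h.2, map_zero, LinearMap.zero_apply, hE.lie_cartan hα, map_smul] at h1
    exact (sub_eq_zero.1 h1.symm)
  refine hE.eq_smul hα ?_
  rw [LieModule.mem_genWeightSpace]
  intro h
  refine ⟨1, ?_⟩
  rw [pow_one, LinearMap.sub_apply]
  have : LieModule.toEnd ℂ H 𝔤 h (tensorOp r (E α)) = ⁅(h : 𝔤), tensorOp r (E α)⁆ := rfl
  rw [this, hcomm]
  simp

theorem tensorOp_cartan {r : 𝔤 ⊗[ℂ] 𝔤}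
    (hr : ∀ h ∈ H, ⁅h, r⁆ = 0) {k : 𝔤} (hk : k ∈ H) : tensorOp r k ∈ H := by
  refine mem_rootSpace_zero.1 ?_
  rw [LieModule.mem_genWeightSpace]
  intro h
  refine ⟨1, ?_⟩
  have h1 := tensorOp_lie (h : 𝔤) r k
  rw [hr h h.2, map_zero, LinearMap.zero_apply, lie_cartan_cartan h.2 hk, map_zero, sub_zero] at h1
  rw [pow_one, LinearMap.sub_apply]
  have : LieModule.toEnd ℂ H 𝔤 h (tensorOp r k) = ⁅(h : 𝔤), tensorOp r k⁆ := rfl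
  rw [this, ← h1]
  simp

/-- The differential equation for the root components of a dynamical r-matrix. -/
theorem IsRootVectors.deriv_of_cdybe (hE : IsRootVectors E) {n : ℕ}
    (x : Module.Basis (Fin n) ℂ H) {r : 𝔤 ⊗[ℂ] 𝔤} (t : Fin n → 𝔤 ⊗[ℂ] 𝔤)
    (hskew : TensorProduct.comm ℂ 𝔤 𝔤 r = - r) (hr : ∀ h ∈ H, ⁅h, r⁆ = 0)
    (hcd : ∑ i, wedge3 (x i : 𝔤) (t i) + cyb r = bracket12_23 (casimir 𝔤) (casimir 𝔤))
    {α : Weight ℂ H 𝔤} (hα : α ∈ H.root) (i : Fin n) :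
    killingForm ℂ 𝔤 (E (-α)) (tensorOp (t i) (E α)) =
      (1 - killingForm ℂ 𝔤 (E (-α)) (tensorOp r (E α)) ^ 2) * dualCoord x α i := by
  set φ := killingForm ℂ 𝔤 (E (-α)) (tensorOp r (E α)) with hφ
  have hRα : tensorOp r (E α) = φ • E α := hE.tensorOp_root hr hα
  have hRneg : tensorOp r (E (-α)) = (-φ) • E (-α) := by
    rw [hE.tensorOp_root hr (neg_mem_root hα), neg_neg, killing_comm, tensorOp_skew hskew, hφ]
  have key : ∀ h : H, ∑ i, killingForm ℂ 𝔤 (x i : 𝔤) h *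
      killingForm ℂ 𝔤 (E (-α)) (tensorOp (t i) (E α)) = (1 - φ ^ 2) * α h := by
    intro h
    have h1 := (cdybe_iff _ _ _ hskew).1 hcd (h : 𝔤) (E (-α)) (E α)
    have hx : ∀ i, killingForm ℂ 𝔤 (x i : 𝔤) (E α) = 0 := fun i => by
      rw [killing_comm, hE.killing_cartan hα (x i).2]
    have hx' : ∀ i, killingForm ℂ 𝔤 (x i : 𝔤) (E (-α)) = 0 := fun i => by
      rw [killing_comm, hE.killing_cartan (neg_mem_root hα) (x i).2]
    have hp : killingForm ℂ 𝔤 (E (-α)) (E α) = 1 := by rw [killing_comm, hE.pair α hα]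
    -- `tensorOp r h` lies in `𝔥` but need not vanish; its two contributions, through `E α` and
    -- through `E (-α)`, cancel.
    have e0 := hE.lie_cartan hα h
    have e1 := hE.lie_cartan hα ⟨_, tensorOp_cartan hr h.2⟩
    have e2 := hE.lie_cartan (neg_mem_root hα) ⟨_, tensorOp_cartan hr h.2⟩
    have e3 : killingForm ℂ 𝔤 (h : 𝔤) ⁅E (-α), E α⁆ = - α h := by
      rw [← killing_lie, hE.lie_cartan (neg_mem_root hα)]
      simp [hp]
    simp only at e1 e2
    simp only [hx, hx', hRα, hRneg, zero_mul, sub_zero, add_zero, lie_smul, smul_lie, map_smul,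
      smul_eq_mul, e0, e1, e2, e3, hp, hE.pair α hα, Weight.coe_neg, Pi.neg_apply] at h1
    linear_combination h1
  -- By `key` and `sum_killing_mul_dualCoord`, this vector of `𝔥` is Killing-orthogonal to all of
  -- `𝔥`.
  have hzero : ∑ i, (killingForm ℂ 𝔤 (E (-α)) (tensorOp (t i) (E α)) -
      (1 - φ ^ 2) * dualCoord x α i) • x i = 0 := by
    refine Subtype.ext (eq_zero_of_killing_cartan (Subtype.mem _) fun k hk => ?_)
    have h1 := key ⟨k, hk⟩
    have h2 := sum_killing_mul_dualCoord x α ⟨k, hk⟩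
    simp only at h1 h2
    have h3 : ((∑ i, (killingForm ℂ 𝔤 (E (-α)) (tensorOp (t i) (E α)) -
      (1 - φ ^ 2) * dualCoord x α i) • x i : H) : 𝔤) =
        ∑ i, (killingForm ℂ 𝔤 (E (-α)) (tensorOp (t i) (E α)) -
      (1 - φ ^ 2) * dualCoord x α i) • (x i : 𝔤) := by
      simp
    rw [h3, map_sum, LinearMap.sum_apply]
    calc _ = ∑ i, (killingForm ℂ 𝔤 (x i : 𝔤) k *
          killingForm ℂ 𝔤 (E (-α)) (tensorOp (t i) (E α)) -
          (1 - φ ^ 2) * (killingForm ℂ 𝔤 (x i : 𝔤) k * dualCoord x α i)) :=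
          Finset.sum_congr rfl fun i _ => by simp; ring
      _ = 0 := by rw [Finset.sum_sub_distrib, ← Finset.mul_sum, h1, h2, sub_self]
  have := (Fintype.linearIndependent_iff.1 x.linearIndependent) _ hzero i
  exact sub_eq_zero.1 this

end

section

open LieAlgebra LieAlgebra.IsKilling LieModule Filter Topology

/-! ### Holomorphic vector-valued functions -/

section Holomorphic

variable {n : ℕ} {M N : Type*} [AddCommGroup M] [Module ℂ M] [AddCommGroup N] [Module ℂ N]

theorem HolAt.congr {f g : (Fin n → ℂ) → M} {l : Fin n → ℂ} (hf : HolAt f l)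
    (h : ∀ᶠ y in 𝓝 l, f y = g y) : HolAt g l :=
  fun φ => (hf φ).congr (h.mono fun y hy => by simp only [hy])

theorem HolAt.const (v : M) (l : Fin n → ℂ) : HolAt (fun _ => v) l :=
  fun _ => analyticAt_const

theorem HolAt.smul {c : (Fin n → ℂ) → ℂ} {f : (Fin n → ℂ) → M} {l : Fin n → ℂ}
    (hc : AnalyticAt ℂ c l) (hf : HolAt f l) : HolAt (fun y => c y • f y) l := fun φ => by
  simp only [map_smul, smul_eq_mul]
  exact hc.mul (hf φ)

theorem HolAt.add {f g : (Fin n → ℂ) → M} {l : Fin n → ℂ} (hf : HolAt f l) (hg : HolAt g l) :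
    HolAt (fun y => f y + g y) l := fun φ => by
  simp only [map_add]
  exact (hf φ).add (hg φ)

theorem HolAt.sum {ι : Type*} {s : Finset ι} {f : ι → (Fin n → ℂ) → M} {l : Fin n → ℂ}
    (hf : ∀ i ∈ s, HolAt (f i) l) : HolAt (fun y => ∑ i ∈ s, f i y) l := fun φ => by
  simp only [map_sum]
  exact Finset.analyticAt_fun_sum s fun i hi => hf i hi φ

variable [FiniteDimensional ℂ M] [FiniteDimensional ℂ N]

theorem dual_eq_sum (φ : Module.Dual ℂ M) (v : M) :
    φ v = ∑ k, (Module.finBasis ℂ M).repr v k * φ (Module.finBasis ℂ M k) := by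
  conv_lhs => rw [← (Module.finBasis ℂ M).sum_repr v]
  simp only [map_sum, map_smul, smul_eq_mul]

/-- Each functional has its own neighbourhood of analyticity; finitely many coordinates control all
functionals on a common one. -/
theorem HolAt.eventually {f : (Fin n → ℂ) → M} {l : Fin n → ℂ} (hf : HolAt f l) :
    ∀ᶠ y in 𝓝 l, HolAt f y := by
  let b := Module.finBasis ℂ M
  have h : ∀ᶠ y in 𝓝 l, ∀ k, AnalyticAt ℂ (fun z => b.coord k (f z)) y :=
    eventually_all.2 fun k => (hf (b.coord k)).eventually_analyticAt
  filter_upwards [h] with y hy φ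
  have : (fun z => φ (f z)) = fun z => ∑ k, b.coord k (f z) * φ (b k) := by
    funext z
    exact dual_eq_sum φ (f z)
  rw [this]
  exact Finset.analyticAt_fun_sum _ fun k _ => (hy k).mul analyticAt_const

theorem HolAt.bilin (B : M →ₗ[ℂ] N →ₗ[ℂ] ℂ) {f : (Fin n → ℂ) → M} {g : (Fin n → ℂ) → N}
    {l : Fin n → ℂ} (hf : HolAt f l) (hg : HolAt g l) : AnalyticAt ℂ (fun y => B (f y) (g y)) l := by
  let b := Module.finBasis ℂ N
  have : (fun y => B (f y) (g y)) = fun y => ∑ k, b.coord k (g y) * B.flip (b k) (f y) := by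
    funext y
    exact dual_eq_sum (B (f y)) (g y)
  rw [this]
  exact Finset.analyticAt_fun_sum _ fun k _ => (hg (b.coord k)).mul (hf (B.flip (b k)))

theorem HolAt.dual_partialDeriv {f : (Fin n → ℂ) → M} {l : Fin n → ℂ} (hf : HolAt f l)
    (ψ : Module.Dual ℂ M) (i : Fin n) :
    ψ (partialDeriv f i l) = fderiv ℂ (fun y => ψ (f y)) l (Pi.single i 1) := by
  let b := Module.finBasis ℂ M
  have hd : ∀ k, DifferentiableAt ℂ (fun y => b.repr (f y) k) l :=
    fun k => (hf (b.coord k)).differentiableAt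
  have : (fun y => ψ (f y)) = fun y => ∑ k, b.repr (f y) k * ψ (b k) := by
    funext y
    exact dual_eq_sum ψ (f y)
  rw [this, fderiv_fun_sum fun k _ => (hd k).mul_const _, partialDeriv, map_sum,
    sum_apply]
  refine Finset.sum_congr rfl fun k _ => ?_
  rw [fderiv_mul_const (hd k), map_smul]
  change lineDeriv ℂ (fun y => b.repr (f y) k) l (Pi.single i 1) • ψ (b k) = _
  rw [(hd k).lineDeriv_eq_fderiv]
  simp [mul_comm]

theorem eq_of_dual {v w : M} (h : ∀ ψ : Module.Dual ℂ M, ψ v = ψ w) : v = w := by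
  rw [← sub_eq_zero, ← Module.forall_dual_apply_eq_zero_iff ℂ]
  intro ψ
  rw [map_sub, h, sub_self]

theorem hasFDerivAt_div {f g : (Fin n → ℂ) → ℂ} {f' g' : (Fin n → ℂ) →L[ℂ] ℂ} {z : Fin n → ℂ}
    (hf : HasFDerivAt f f' z) (hg : HasFDerivAt g g' z) (h0 : f z ≠ 0) :
    HasFDerivAt (fun y => g y / f y) ((f z ^ 2)⁻¹ • (f z • g' - g z • f')) z := by
  have h1 := hg.mul ((hasDerivAt_inv h0).comp_hasFDerivAt z hf)
  have h2 : (f z ^ 2)⁻¹ • (f z • g' - g z • f') =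
      g z • -(f z ^ 2)⁻¹ • f' + ((fun y => y⁻¹) ∘ f) z • g' := by
    ext v
    simp
    field_simp
    ring
  simp only [div_eq_mul_inv]
  rw [h2]
  exact h1

/-- Two functions with the same logarithmic derivative are proportional. -/
theorem eventually_mul_eq_mul {f g : (Fin n → ℂ) → ℂ} {m : (Fin n → ℂ) → Fin n → ℂ}
    {l : Fin n → ℂ}
    (hf : ∀ᶠ y in 𝓝 l, DifferentiableAt ℂ f y ∧
      ∀ i, fderiv ℂ f y (Pi.single i 1) = m y i * f y)
    (hg : ∀ᶠ y in 𝓝 l, DifferentiableAt ℂ g y ∧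
      ∀ i, fderiv ℂ g y (Pi.single i 1) = m y i * g y)
    (h0 : f l ≠ 0) : ∀ᶠ y in 𝓝 l, g y * f l = f y * g l := by
  have hne : ∀ᶠ y in 𝓝 l, f y ≠ 0 :=
    hf.self_of_nhds.1.continuousAt.eventually_ne h0
  obtain ⟨ε, hε, hball⟩ := Metric.eventually_nhds_iff_ball.1 (hf.and (hg.and hne))
  refine Metric.eventually_nhds_iff_ball.2 ⟨ε, hε, fun y hy => ?_⟩
  -- The numerator `f g' - g f'` of the quotient rule vanishes in every coordinate direction.
  have hd : ∀ z ∈ Metric.ball l ε, HasFDerivAt (fun w => g w / f w) (0 : (Fin n → ℂ) →L[ℂ] ℂ) z := by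
    intro z hz
    obtain ⟨⟨hf1, hf2⟩, ⟨hg1, hg2⟩, hf0⟩ := hball z hz
    have h1 := hasFDerivAt_div hf1.hasFDerivAt hg1.hasFDerivAt hf0
    convert h1 using 1
    refine ContinuousLinearMap.coe_injective (LinearMap.pi_ext' fun i => LinearMap.ext_ring ?_)
    simp only [LinearMap.comp_apply, LinearMap.single_apply, ContinuousLinearMap.coe_coe]
    simp [hf2, hg2]
    right
    ring
  have h2 := Metric.isOpen_ball.is_const_of_fderiv_eq_zero
    (convex_ball l ε).isPreconnected
    (fun z hz => (hd z hz).differentiableAt.differentiableWithinAt)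
    (fun z hz => (hd z hz).fderiv) hy (Metric.mem_ball_self hε)
  have h3 := (hball y hy).2.2
  have h4 : f l ≠ 0 := h0
  field_simp at h2
  linear_combination h2

end Holomorphic

/-! ### The point of `𝔥` with given coordinates -/

variable {𝔤 : Type*} [LieRing 𝔤] [LieAlgebra ℂ 𝔤] [FiniteDimensional ℂ 𝔤] [IsKilling ℂ 𝔤]
variable {H : LieSubalgebra ℂ 𝔤} [H.IsCartanSubalgebra] {E : Weight ℂ H 𝔤 → 𝔤}

section Point

variable {n : ℕ} (x : Module.Basis (Fin n) ℂ H)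

/-- The element of `𝔥` that corresponds to `∑ vᵢ xᵢ* ∈ 𝔥*` under the Killing form. -/
def cartanPoint (v : Fin n → ℂ) : H := (cartanEquivDual H).symm (∑ i, v i • x.coord i)

theorem cartanPoint_zero : cartanPoint x 0 = 0 := by simp [cartanPoint]

theorem weight_cartanPoint (α : Weight ℂ H 𝔤) (v : Fin n → ℂ) :
    α (cartanPoint x v) = ∑ i, v i * dualCoord x α i := by
  rw [← Weight.toLinear_apply, ← killing_cartanEquivDual_symm, killing_comm, cartanPoint,
    killing_cartanEquivDual_symm]
  simp [dualCoord]

theorem analyticAt_weight_cartanPoint (α : Weight ℂ H 𝔤) (μ l : Fin n → ℂ) :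
    AnalyticAt ℂ (fun y => α (cartanPoint x (y - μ))) l := by
  simp only [weight_cartanPoint, Pi.sub_apply]
  exact Finset.analyticAt_fun_sum _ fun j _ =>
    (((ContinuousLinearMap.proj j : (Fin n → ℂ) →L[ℂ] ℂ).analyticAt l).sub
      analyticAt_const).mul analyticAt_const

theorem fderiv_weight_cartanPoint (α : Weight ℂ H 𝔤) (μ l : Fin n → ℂ) (i : Fin n) :
    fderiv ℂ (fun y => α (cartanPoint x (y - μ))) l (Pi.single i 1) = dualCoord x α i := by
  rw [← (analyticAt_weight_cartanPoint x α μ l).differentiableAt.lineDeriv_eq_fderiv, lineDeriv]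
  have : (fun t : ℂ => α (cartanPoint x (l + t • Pi.single i 1 - μ))) =
      fun t => α (cartanPoint x (l - μ)) + t * dualCoord x α i := by
    funext t
    have : ∀ j, (l + t • (Pi.single i 1 : Fin n → ℂ) - μ) j * dualCoord x α j =
        (l - μ) j * dualCoord x α j +
          t * ((Pi.single i 1 : Fin n → ℂ) j * dualCoord x α j) := by
      intro j
      simp only [Pi.sub_apply, Pi.add_apply, Pi.smul_apply, smul_eq_mul]
      ring
    rw [weight_cartanPoint, weight_cartanPoint, Finset.sum_congr rfl fun j _ => this j,
      Finset.sum_add_distrib, ← Finset.mul_sum]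
    congr 2
    simp [Pi.single_apply]
  rw [this]
  simp

theorem holAt_twist (hE : IsRootVectors E) (μ : Fin n → ℂ) (w : 𝔤 × 𝔤) (l : Fin n → ℂ) :
    HolAt (fun y => twist hE (cartanPoint x (y - μ)) w) l := by
  have h : (fun y => twist hE (cartanPoint x (y - μ)) w) = fun y => w +
      ((∑ α ∈ H.root, (Complex.exp (-α (cartanPoint x (y - μ))) - 1) •
          (killingForm ℂ 𝔤 (E (-α)) w.1 • ((E α, 0) : 𝔤 × 𝔤))) +
      ∑ α ∈ H.root, (Complex.exp (α (cartanPoint x (y - μ))) - 1) •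
          (killingForm ℂ 𝔤 (E (-α)) w.2 • ((0, E α) : 𝔤 × 𝔤))) := by
    funext y
    have hneg : ∀ α : Weight ℂ H 𝔤, α (-(cartanPoint x (y - μ))) = -α (cartanPoint x (y - μ)) :=
      fun α => by rw [← Weight.toLinear_apply, map_neg]; rfl
    ext
    · simp only [twist_apply, cartanExp, LinearMap.add_apply, LinearMap.id_apply, rootOp_apply,
        Prod.fst_add, Prod.fst_sum, Prod.smul_fst, smul_zero, Finset.sum_const_zero, add_zero,
        hneg, smul_smul]
    · simp only [twist_apply, cartanExp, LinearMap.add_apply, LinearMap.id_apply, rootOp_apply,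
        Prod.snd_add, Prod.snd_sum, Prod.smul_snd, smul_zero, Finset.sum_const_zero, zero_add,
        smul_smul]
  rw [h]
  refine (HolAt.const w l).add (HolAt.add (HolAt.sum fun α _ => HolAt.smul ?_ (HolAt.const _ l))
    (HolAt.sum fun α _ => HolAt.smul ?_ (HolAt.const _ l)))
  · exact (analyticAt_weight_cartanPoint x α μ l).neg.cexp.sub analyticAt_const
  · exact (analyticAt_weight_cartanPoint x α μ l).cexp.sub analyticAt_const

end Point

end

section

open LieAlgebra LieAlgebra.IsKilling LieModule Filter Topology

variable {𝔤 : Type*} [LieRing 𝔤] [LieAlgebra ℂ 𝔤] [FiniteDimensional ℂ 𝔤] [IsKilling ℂ 𝔤]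
variable {H : LieSubalgebra ℂ 𝔤} [H.IsCartanSubalgebra] {E : Weight ℂ H 𝔤 → 𝔤}

/-! ### The family through a given Lagrangian subalgebra -/

theorem HasCayleyVectors.meetsDiagonalIn (hE : IsRootVectors E)
    {W : LieSubalgebra ℂ (𝔤 × 𝔤)} (hW : IsLagrangian W) (hWH : ∀ h ∈ H, (h, h) ∈ W)
    {φ : Weight ℂ H 𝔤 → ℂ} (hφ : HasCayleyVectors E W φ) : MeetsDiagonalIn H W := by
  refine fun X => ⟨fun hX => hE.mem_cartan_of_killing fun α hα => ?_, hWH X⟩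
  have h4 := hW.isotropic _ (hφ (-α) (neg_mem_root hα)) _ hX
  simp only [doubleForm, map_smul, LinearMap.smul_apply, smul_eq_mul] at h4
  linear_combination h4

/-! ### Transported Cayley vectors and their coefficients -/

variable {n : ℕ} (x : Module.Basis (Fin n) ℂ H) (μ : Fin n → ℂ) (φ₀ : Weight ℂ H 𝔤 → ℂ)

/-- The first component of the transported Cayley vector. -/
def cayleyFst (α : Weight ℂ H 𝔤) (y : Fin n → ℂ) : ℂ :=
  Complex.exp (-α (cartanPoint x (y - μ))) * (φ₀ α - 1)

/-- The second component of the transported Cayley vector. -/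
def cayleySnd (α : Weight ℂ H 𝔤) (y : Fin n → ℂ) : ℂ :=
  Complex.exp (α (cartanPoint x (y - μ))) * (φ₀ α + 1)

/-- The root coefficients of the r-matrix. -/
def cayleyQuot (y : Fin n → ℂ) (α : Weight ℂ H 𝔤) : ℂ :=
  (cayleySnd x μ φ₀ α y + cayleyFst x μ φ₀ α y) / (cayleySnd x μ φ₀ α y - cayleyFst x μ φ₀ α y)

/-- The denominator of the root coefficients. -/
def cayleyDen (α : Weight ℂ H 𝔤) (y : Fin n → ℂ) : ℂ :=
  cayleySnd x μ φ₀ α y - cayleyFst x μ φ₀ α y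

theorem analyticAt_cayleyFst (α : Weight ℂ H 𝔤) (l : Fin n → ℂ) :
    AnalyticAt ℂ (cayleyFst x μ φ₀ α) l :=
  (analyticAt_weight_cartanPoint x α μ l).neg.cexp.mul analyticAt_const

theorem analyticAt_cayleySnd (α : Weight ℂ H 𝔤) (l : Fin n → ℂ) :
    AnalyticAt ℂ (cayleySnd x μ φ₀ α) l :=
  (analyticAt_weight_cartanPoint x α μ l).cexp.mul analyticAt_const

theorem analyticAt_cayleyDen (α : Weight ℂ H 𝔤) (l : Fin n → ℂ) :
    AnalyticAt ℂ (cayleyDen x μ φ₀ α) l :=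
  (analyticAt_cayleySnd x μ φ₀ α l).sub (analyticAt_cayleyFst x μ φ₀ α l)

theorem cayleyDen_base (α : Weight ℂ H 𝔤) : cayleyDen x μ φ₀ α μ = 2 := by
  have : α (0 : H) = 0 := by rw [← Weight.toLinear_apply, map_zero]
  simp only [cayleyDen, cayleySnd, cayleyFst, sub_self, cartanPoint_zero, this, neg_zero,
    Complex.exp_zero]
  ring

/-- Identity theorem on all of `ℂⁿ`. For the denominators, the nonzero value is the `2` at `μ`. -/
theorem not_eventually_zero {f : (Fin n → ℂ) → ℂ} (hf : ∀ l, AnalyticAt ℂ f l) (h : f μ ≠ 0)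
    (l : Fin n → ℂ) : ¬ ∀ᶠ y in 𝓝 l, f y = 0 := by
  intro h0
  have h1 : AnalyticOnNhd ℂ f Set.univ := fun y _ => hf y
  have h2 := h1.eqOn_zero_of_preconnected_of_eventuallyEq_zero isPreconnected_univ
    (Set.mem_univ l) h0
  exact h (h2 (Set.mem_univ μ))

/-- With `s`, `t` the transported components, `∂ᵢ s = -αᵢ s` and `∂ᵢ t = αᵢ t`. So `∂ᵢ` sends `t +
s` to `αᵢ (t - s)` and `t - s` to `αᵢ (t + s)`, and the quotient rule gives the Riccati equation. -/
theorem fderiv_cayleyQuot {α : Weight ℂ H 𝔤} {l : Fin n → ℂ}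
    (h : cayleyDen x μ φ₀ α l ≠ 0) (i : Fin n) :
    fderiv ℂ (fun y => cayleyQuot x μ φ₀ y α) l (Pi.single i 1) =
      (1 - cayleyQuot x μ φ₀ l α ^ 2) * dualCoord x α i := by
  have ha := (analyticAt_weight_cartanPoint x α μ l).differentiableAt.hasFDerivAt
  have h1 : HasFDerivAt (cayleyFst x μ φ₀ α) _ l := ha.fun_neg.cexp.mul_const (φ₀ α - 1)
  have h2 : HasFDerivAt (cayleySnd x μ φ₀ α) _ l := ha.cexp.mul_const (φ₀ α + 1)
  have h3 := hasFDerivAt_div (h2.sub h1) (h2.add h1) h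
  have h4 : (fun y => cayleyQuot x μ φ₀ y α) = fun y =>
      (cayleySnd x μ φ₀ α + cayleyFst x μ φ₀ α) y /
        (cayleySnd x μ φ₀ α - cayleyFst x μ φ₀ α) y := rfl
  rw [h4, h3.fderiv]
  have h5 : cayleySnd x μ φ₀ α l - cayleyFst x μ φ₀ α l ≠ 0 := h
  have e1 : Complex.exp (-α (cartanPoint x (l - μ))) * (φ₀ α - 1) = cayleyFst x μ φ₀ α l := rfl
  have e2 : Complex.exp (α (cartanPoint x (l - μ))) * (φ₀ α + 1) = cayleySnd x μ φ₀ α l := rfl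
  have e3 : (fderiv ℂ (fun y => α (cartanPoint x (y - μ))) l) (Pi.single i 1) =
    dualCoord x α i := fderiv_weight_cartanPoint x α μ l i
  simp only [Pi.add_apply, Pi.sub_apply, _root_.sub_apply, _root_.add_apply, _root_.smul_apply,
    _root_.neg_apply, smul_eq_mul, e3, cayleyQuot]
  have e4 : (φ₀ α - 1) * (Complex.exp (-α (cartanPoint x (l - μ))) * -dualCoord x α i) =
      - (cayleyFst x μ φ₀ α l * dualCoord x α i) := by rw [← e1]; ring
  have e5 : (φ₀ α + 1) * (Complex.exp (α (cartanPoint x (l - μ))) * dualCoord x α i) =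
      cayleySnd x μ φ₀ α l * dualCoord x α i := by rw [← e2]; ring
  rw [e4, e5]
  field_simp
  ring

variable {x μ φ₀}

theorem cayleyVector_mem (hE : IsRootVectors E) {W₀ : LieSubalgebra ℂ (𝔤 × 𝔤)}
    (hφ₀ : HasCayleyVectors E W₀ φ₀) {α : Weight ℂ H 𝔤} (hα : α ∈ H.root) (y : Fin n → ℂ) :
    (cayleyFst x μ φ₀ α y • E α, cayleySnd x μ φ₀ α y • E α) ∈
      W₀.map (twist hE (cartanPoint x (y - μ))) := by
  rw [LieSubalgebra.mem_map]
  exact ⟨_, hφ₀ α hα, twist_root hE _ hα _ _⟩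

theorem cartan_mem_map_twist (hE : IsRootVectors E) {W : LieSubalgebra ℂ (𝔤 × 𝔤)}
    (hW : ∀ h ∈ H, (h, h) ∈ W) (k : H) : ∀ h ∈ H, (h, h) ∈ W.map (twist hE k) := by
  intro h hh
  rw [mem_map_twist, twist_cartan hE _ hh]
  exact hW h hh

theorem hasCayleyVectors_map_twist (hE : IsRootVectors E) {W₀ : LieSubalgebra ℂ (𝔤 × 𝔤)}
    (hφ₀ : HasCayleyVectors E W₀ φ₀) {y : Fin n → ℂ}
    (h : ∀ α ∈ H.root, cayleyDen x μ φ₀ α y ≠ 0) :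
    HasCayleyVectors E (W₀.map (twist hE (cartanPoint x (y - μ)))) (cayleyQuot x μ φ₀ y) := by
  intro α hα
  -- The factor makes the difference of the two components equal to `2 E α`, as in a Cayley vector.
  have h1 := (W₀.map (twist hE (cartanPoint x (y - μ)))).smul_mem
    (2 / cayleyDen x μ φ₀ α y) (cayleyVector_mem hE hφ₀ hα y)
  have h2 : cayleySnd x μ φ₀ α y - cayleyFst x μ φ₀ α y ≠ 0 := h α hα
  convert h1 using 1
  ext
  · simp only [Prod.smul_fst, smul_smul, cayleyQuot, cayleyDen]
    congr 1
    field_simp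
    ring
  · simp only [Prod.smul_snd, smul_smul, cayleyQuot, cayleyDen]
    congr 1
    field_simp
    ring

theorem cayleyFst_or_cayleySnd_ne_zero (α : Weight ℂ H 𝔤) (y : Fin n → ℂ)
    (h1 : cayleyFst x μ φ₀ α y = 0) (h2 : cayleySnd x μ φ₀ α y = 0) : False := by
  have h3 := (mul_eq_zero.1 h1).resolve_left (Complex.exp_ne_zero _)
  have h4 := (mul_eq_zero.1 h2).resolve_left (Complex.exp_ne_zero _)
  have : (2 : ℂ) = 0 := by linear_combination h4 - h3
  exact two_ne_zero this

/-- Where a denominator vanishes, the transported vector is a nonzero multiple of `(E α, E α)`, a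
diagonal element outside `𝔥`. Otherwise all transported vectors can be normalized to Cayley vectors.
-/
theorem meetsDiagonalIn_map_twist_iff (hE : IsRootVectors E) {W₀ : LieSubalgebra ℂ (𝔤 × 𝔤)}
    (hW₀ : IsLagrangian W₀) (hW₀H : MeetsDiagonalIn H W₀)
    (hφ₀ : HasCayleyVectors E W₀ φ₀) (y : Fin n → ℂ) :
    MeetsDiagonalIn H (W₀.map (twist hE (cartanPoint x (y - μ)))) ↔
      ∀ α ∈ H.root, cayleyDen x μ φ₀ α y ≠ 0 := by
  constructor
  · intro h α hα h0
    have h1 : cayleySnd x μ φ₀ α y = cayleyFst x μ φ₀ α y := sub_eq_zero.1 h0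
    have h2 := cayleyVector_mem (x := x) (μ := μ) hE hφ₀ hα y
    rw [h1] at h2
    have h3 := (h _).1 h2
    have h4 : cayleyFst x μ φ₀ α y = 0 := by
      by_contra hne
      refine hE.notMem_cartan hα ?_
      have := H.smul_mem (cayleyFst x μ φ₀ α y)⁻¹ h3
      rwa [inv_smul_smul₀ hne] at this
    exact cayleyFst_or_cayleySnd_ne_zero α y h4 (h1.trans h4)
  · intro h
    exact (hasCayleyVectors_map_twist hE hφ₀ h).meetsDiagonalIn hE (hW₀.map_twist hE _)
      (cartan_mem_map_twist hE (fun X hX => (hW₀H X).2 hX) _)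

/-! ### Poles of the r-matrix, and the properties required of it and of the family -/

variable (x μ φ₀)

theorem holAt_rootTensor_iff (hE : IsRootVectors E) (l : Fin n → ℂ) :
    HolAt (fun y => rootTensor E (cayleyQuot x μ φ₀ y)) l ↔
      ∀ α ∈ H.root, cayleyDen x μ φ₀ α l ≠ 0 := by
  constructor
  · intro h α hα h0
    have h1 : AnalyticAt ℂ (fun y => cayleyQuot x μ φ₀ y α) l := by
      have := h (killingForm ℂ 𝔤 (E (-α)) ∘ₗ tensorOp.flip (E α))
      refine this.congr (Eventually.of_forall fun y => ?_)
      simp only [LinearMap.comp_apply, LinearMap.flip_apply, tensorOp_rootTensor,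
        hE.rootOp_root _ hα, map_smul]
      rw [killing_comm, hE.pair α hα]
      simp
    -- This function vanishes wherever the denominator does not, that is, at points arbitrarily
    -- close to `l`; by continuity it vanishes at `l`. So numerator and denominator would both be
    -- zero there, which is impossible. The value that division by zero assigns plays no role.
    have h2 : ContinuousAt (fun y => cayleyQuot x μ φ₀ y α * cayleyDen x μ φ₀ α y -
        (cayleySnd x μ φ₀ α y + cayleyFst x μ φ₀ α y)) l :=
      ((h1.mul (analyticAt_cayleyDen x μ φ₀ α l)).sub
        ((analyticAt_cayleySnd x μ φ₀ α l).add (analyticAt_cayleyFst x μ φ₀ α l))).continuousAt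
    have h3 : cayleySnd x μ φ₀ α l + cayleyFst x μ φ₀ α l = 0 := by
      by_contra hne
      have h4 := h2.eventually_ne (y := 0)
        (by simp only [h0, mul_zero, zero_sub]; exact neg_ne_zero.2 hne)
      refine not_eventually_zero μ (analyticAt_cayleyDen x μ φ₀ α)
        (by rw [cayleyDen_base]; exact two_ne_zero) l ?_
      filter_upwards [h4] with y hy
      by_contra hd
      refine hy ?_
      have hd' : cayleySnd x μ φ₀ α y - cayleyFst x μ φ₀ α y ≠ 0 := hd
      simp only [cayleyQuot, cayleyDen]
      field_simp
      ring
    have h0' : cayleySnd x μ φ₀ α l - cayleyFst x μ φ₀ α l = 0 := h0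
    exact cayleyFst_or_cayleySnd_ne_zero (x := x) (μ := μ) (φ₀ := φ₀) α l
      (by linear_combination (1 / 2 : ℂ) * (h3 - h0'))
      (by linear_combination (1 / 2 : ℂ) * (h3 + h0'))
  · intro h
    refine HolAt.sum fun α hα => HolAt.smul ?_ (HolAt.const _ l)
    exact ((analyticAt_cayleySnd x μ φ₀ α l).add (analyticAt_cayleyFst x μ φ₀ α l)).div
      (analyticAt_cayleyDen x μ φ₀ α l) (h α hα)

theorem meromorphic_rootTensor (U : Set (Fin n → ℂ)) :
    MeromorphicOnSet U (fun y => rootTensor E (cayleyQuot x μ φ₀ y)) := by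
  classical
  intro l _
  have hp : ∀ (s : Finset (Weight ℂ H 𝔤)) y,
      AnalyticAt ℂ (fun z => ∏ α ∈ s, cayleyDen x μ φ₀ α z) y := fun s y =>
    Finset.analyticAt_fun_prod _ fun α _ => analyticAt_cayleyDen x μ φ₀ α y
  -- The product of all root denominators serves as common denominator.
  refine ⟨fun y => ∏ α ∈ H.root, cayleyDen x μ φ₀ α y,
    fun y => ∑ α ∈ H.root, ((∏ β ∈ H.root.erase α, cayleyDen x μ φ₀ β y) *
      (cayleySnd x μ φ₀ α y + cayleyFst x μ φ₀ α y)) • (E α ⊗ₜ[ℂ] E (-α)), hp _ l,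
    HolAt.sum fun α _ => HolAt.smul ((hp _ l).mul ((analyticAt_cayleySnd x μ φ₀ α l).add
      (analyticAt_cayleyFst x μ φ₀ α l))) (HolAt.const _ l),
    not_eventually_zero μ (hp _) ?_ l, Eventually.of_forall fun y hy => ?_⟩
  · simp [cayleyDen_base]
  · simp only [rootTensor, Finset.smul_sum]
    refine Finset.sum_congr rfl fun α hα => ?_
    rw [smul_smul]
    congr 1
    simp only at hy
    rw [← Finset.mul_prod_erase _ _ hα] at hy ⊢
    have h1 := left_ne_zero_of_mul hy
    have h2 := right_ne_zero_of_mul hy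
    change _ / cayleyDen x μ φ₀ α y = _
    field_simp

/-- At a holomorphic point the coefficients are those of the Cayley vectors of the Lagrangian
subalgebra `W l`, which supplies skewness and the relations on triples; `fderiv_cayleyQuot` supplies
the derivatives. -/
theorem isDynamicalRMatrix_rootTensor (hE : IsRootVectors E) {W₀ : LieSubalgebra ℂ (𝔤 × 𝔤)}
    (hW₀ : IsLagrangian W₀) (hφ₀ : HasCayleyVectors E W₀ φ₀) (U : Set (Fin n → ℂ)) :
    IsDynamicalRMatrix H x U (fun y => rootTensor E (cayleyQuot x μ φ₀ y)) where
  meromorphic := meromorphic_rootTensor x μ φ₀ U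
  skew l _ hl := by
    have h1 := hasCayleyVectors_map_twist hE hφ₀ ((holAt_rootTensor_iff x μ φ₀ hE l).1 hl)
    exact comm_rootTensor fun α hα => h1.neg hE (hW₀.map_twist hE _) hα
  weight_zero l _ _ h hh := hE.lie_rootTensor _ hh
  cdybe l _ hl := by
    have h0 := (holAt_rootTensor_iff x μ φ₀ hE l).1 hl
    have h1 := hasCayleyVectors_map_twist hE hφ₀ h0
    have h2 := hW₀.map_twist hE (cartanPoint x (l - μ))
    rw [← hE.cdybe_rootTensor x (fun α hα => h1.neg hE h2 hα)
      (fun α hα β hβ γ hγ => h1.triple h2 hα hβ hγ)]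
    congr 1
    refine Finset.sum_congr rfl fun i _ => ?_
    congr 1
    refine eq_of_dual fun ψ => ?_
    rw [hl.dual_partialDeriv]
    have h3 : ∀ α ∈ H.root, DifferentiableAt ℂ (fun y => cayleyQuot x μ φ₀ y α) l := fun α hα =>
      (((analyticAt_cayleySnd x μ φ₀ α l).add (analyticAt_cayleyFst x μ φ₀ α l)).div
        (analyticAt_cayleyDen x μ φ₀ α l) (h0 α hα)).differentiableAt
    simp only [rootTensor, map_sum, map_smul, smul_eq_mul]
    rw [fderiv_fun_sum fun α hα => (h3 α hα).mul_const _, _root_.sum_apply]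
    refine Finset.sum_congr rfl fun α hα => ?_
    rw [fderiv_mul_const (h3 α hα), _root_.smul_apply, fderiv_cayleyQuot x μ φ₀ (h0 α hα)]
    simp only [smul_eq_mul]
    ring

theorem isLagrangianFamily_map_twist (hE : IsRootVectors E) {W₀ : LieSubalgebra ℂ (𝔤 × 𝔤)}
    (hW₀ : IsLagrangian W₀) (U : Set (Fin n → ℂ)) :
    IsLagrangianFamily U (fun y => W₀.map (twist hE (cartanPoint x (y - μ)))) where
  lagrangian l _ := hW₀.map_twist hE _
  holomorphic l _ := by
    let w := Module.finBasis ℂ W₀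
    refine ⟨_, fun j y => twist hE (cartanPoint x (y - μ)) (w j), fun j => holAt_twist x hE μ _ l,
      Eventually.of_forall fun y => ⟨?_, ?_⟩⟩
    · have h1 : LinearIndependent ℂ (fun j => (w j : 𝔤 × 𝔤)) :=
        w.linearIndependent.map' W₀.toSubmodule.subtype (Submodule.ker_subtype _)
      exact h1.map' (twist hE (cartanPoint x (y - μ)) : 𝔤 × 𝔤 →ₗ[ℂ] 𝔤 × 𝔤)
        (LinearMap.ker_eq_bot.2 (twist_injective hE _))
    · have h1 : Submodule.span ℂ (Set.range fun j => (w j : 𝔤 × 𝔤)) = W₀.toSubmodule := by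
        have h2 := congrArg (Submodule.map W₀.toSubmodule.subtype) w.span_eq
        rw [Submodule.map_span, ← Set.range_comp, Submodule.map_top,
          Submodule.range_subtype] at h2
        exact h2
      have h3 : (W₀.map (twist hE (cartanPoint x (y - μ)))).toSubmodule =
          W₀.toSubmodule.map (twist hE (cartanPoint x (y - μ)) : 𝔤 × 𝔤 →ₗ[ℂ] 𝔤 × 𝔤) := rfl
      rw [h3, ← h1, Submodule.map_span, ← Set.range_comp]
      rfl

theorem map_twist_base (hE : IsRootVectors E) (W₀ : LieSubalgebra ℂ (𝔤 × 𝔤)) :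
    W₀.map (twist hE (cartanPoint x (μ - μ))) = W₀ := by
  refine SetLike.ext fun z => ?_
  rw [mem_map_twist, sub_self, cartanPoint_zero, neg_zero, twist_zero]

theorem isGovernedBy_rootTensor (hE : IsRootVectors E) (b : (rootSystem H).Base)
    {W₀ : LieSubalgebra ℂ (𝔤 × 𝔤)} (hW₀ : IsLagrangian W₀) (hW₀H : MeetsDiagonalIn H W₀)
    (hφ₀ : HasCayleyVectors E W₀ φ₀) (U : Set (Fin n → ℂ)) :
    IsGovernedBy H b E U (fun y => W₀.map (twist hE (cartanPoint x (y - μ))))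
      (fun y => rootTensor E (cayleyQuot x μ φ₀ y)) := by
  intro l _ hl
  have h1 := hasCayleyVectors_map_twist hE hφ₀ ((holAt_rootTensor_iff x μ φ₀ hE l).1 hl)
  rw [hE.characteristicSpace_eq]
  refine h1.eq_cayleySpace hE (hW₀.map_twist hE _)
    (cartan_mem_map_twist hE (fun X hX => (hW₀H X).2 hX) _) fun α hα => ?_
  rw [tensorOp_rootTensor, hE.rootOp_root _ hα]

end

section

open LieAlgebra LieAlgebra.IsKilling LieModule Filter Topology

variable {𝔤 : Type*} [LieRing 𝔤] [LieAlgebra ℂ 𝔤] [FiniteDimensional ℂ 𝔤] [IsKilling ℂ 𝔤]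
variable {H : LieSubalgebra ℂ 𝔤} [H.IsCartanSubalgebra] {E : Weight ℂ H 𝔤 → 𝔤}

/-! ### Uniqueness -/

/-- Holomorphic points accumulate at every point of `U`, poles included: any nearby point where the
local denominator is nonzero will do. -/
theorem MeromorphicOnSet.frequently_holAt {n : ℕ} {M : Type*} [AddCommGroup M] [Module ℂ M]
    [FiniteDimensional ℂ M] {U : Set (Fin n → ℂ)} {f : (Fin n → ℂ) → M}
    (hf : MeromorphicOnSet U f) {l : Fin n → ℂ} (hl : l ∈ U) : ∃ᶠ y in 𝓝 l, HolAt f y := by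
  obtain ⟨p, q, hp, hq, hne, hpq⟩ := hf l hl
  have h1 : ∃ᶠ y in 𝓝 l, p y ≠ 0 := Filter.not_eventually.1 hne
  refine (h1.and_eventually (hp.eventually_analyticAt.and
    (hq.eventually.and hpq.eventually_nhds))).mono fun y ⟨hy, hpy, hqy, hpqy⟩ => ?_
  refine HolAt.congr (HolAt.smul (hpy.inv hy) hqy) ?_
  filter_upwards [hpqy, hpy.continuousAt.eventually_ne hy] with z hz hz0
  exact (hz hz0).symm

variable {n : ℕ} (x : Module.Basis (Fin n) ℂ H)

theorem cartanPoint_sub (v w : Fin n → ℂ) :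
    cartanPoint x (v - w) = cartanPoint x v - cartanPoint x w := by
  simp only [cartanPoint, Pi.sub_apply, sub_smul, Finset.sum_sub_distrib, map_sub]

/-- The Cayley vectors of a solution are transported by the twist. -/
theorem cayley_transport {φ : (Fin n → ℂ) → ℂ} {α : Weight ℂ H 𝔤} {l : Fin n → ℂ}
    (hφ : ∀ᶠ y in 𝓝 l, DifferentiableAt ℂ φ y ∧
      ∀ i, fderiv ℂ φ y (Pi.single i 1) = (1 - φ y ^ 2) * dualCoord x α i) :
    ∀ᶠ y in 𝓝 l,
      (φ y - 1) * Complex.exp (α (cartanPoint x (y - l))) * (φ l + 1) =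
        (φ y + 1) * Complex.exp (-α (cartanPoint x (y - l))) * (φ l - 1) := by
  -- By the Riccati equation both `(φ - 1) exp α` and `(φ + 1) exp (-α)` have logarithmic derivative
  -- `-φ αᵢ`. Their values at `l`, namely `φ l - 1` and `φ l + 1`, are not both zero, so one of them
  -- can serve as denominator.
  let m : (Fin n → ℂ) → Fin n → ℂ := fun y i => -φ y * dualCoord x α i
  have ha : ∀ y, HasFDerivAt (fun y => α (cartanPoint x (y - l))) _ y := fun y =>
    (analyticAt_weight_cartanPoint x α l y).differentiableAt.hasFDerivAt
  let f : (Fin n → ℂ) → ℂ := fun y => (φ y - 1) * Complex.exp (α (cartanPoint x (y - l)))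
  let g : (Fin n → ℂ) → ℂ := fun y => (φ y + 1) * Complex.exp (-α (cartanPoint x (y - l)))
  have hf : ∀ᶠ y in 𝓝 l, DifferentiableAt ℂ f y ∧
      ∀ i, fderiv ℂ f y (Pi.single i 1) = m y i * f y := by
    filter_upwards [hφ] with y ⟨hy, hy'⟩
    have h1 : HasFDerivAt f _ y := (hy.hasFDerivAt.sub_const 1).mul (ha y).cexp
    refine ⟨h1.differentiableAt, fun i => ?_⟩
    rw [h1.fderiv]
    simp only [_root_.add_apply, _root_.smul_apply, smul_eq_mul, fderiv_weight_cartanPoint, hy',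
      f, m]
    ring
  have hg : ∀ᶠ y in 𝓝 l, DifferentiableAt ℂ g y ∧
      ∀ i, fderiv ℂ g y (Pi.single i 1) = m y i * g y := by
    filter_upwards [hφ] with y ⟨hy, hy'⟩
    have h1 : HasFDerivAt g _ y := (hy.hasFDerivAt.add_const 1).mul (ha y).fun_neg.cexp
    refine ⟨h1.differentiableAt, fun i => ?_⟩
    rw [h1.fderiv]
    simp only [_root_.add_apply, _root_.smul_apply, _root_.neg_apply, smul_eq_mul,
      fderiv_weight_cartanPoint, hy', g, m]
    ring
  have h0 : α (cartanPoint x (l - l)) = 0 := by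
    rw [sub_self, cartanPoint_zero, ← Weight.toLinear_apply, map_zero]
  have hfl : f l = φ l - 1 := by simp only [f, h0, Complex.exp_zero, mul_one]
  have hgl : g l = φ l + 1 := by simp only [g, h0, neg_zero, Complex.exp_zero, mul_one]
  by_cases h : f l = 0
  · have hgne : g l ≠ 0 := by
      intro hg0
      rw [hfl] at h
      rw [hgl] at hg0
      have : (2 : ℂ) = 0 := by linear_combination hg0 - h
      exact two_ne_zero this
    filter_upwards [eventually_mul_eq_mul hg hf hgne] with y hy
    rw [hfl, hgl] at hy
    exact hy
  · filter_upwards [eventually_mul_eq_mul hf hg h] with y hy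
    rw [hfl, hgl] at hy
    exact hy.symm

/-- Near a point where the r-matrix is holomorphic, the family is transported by the twist. -/
theorem eventually_twist_mem (hE : IsRootVectors E) (b : (rootSystem H).Base)
    {U : Set (Fin n → ℂ)} (hU : IsOpen U) {W : (Fin n → ℂ) → LieSubalgebra ℂ (𝔤 × 𝔤)}
    {r : (Fin n → ℂ) → 𝔤 ⊗[ℂ] 𝔤} (hr : IsDynamicalRMatrix H x U r)
    (hW : IsGovernedBy H b E U W r) {l : Fin n → ℂ} (hl : l ∈ U) (hrl : HolAt r l) :
    ∀ᶠ y in 𝓝 l, ∀ z ∈ W l, twist hE (cartanPoint x (y - l)) z ∈ W y := by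
  let φ : Weight ℂ H 𝔤 → (Fin n → ℂ) → ℂ := fun α y =>
    killingForm ℂ 𝔤 (E (-α)) (tensorOp (r y) (E α))
  have hgood : ∀ᶠ y in 𝓝 l, y ∈ U ∧ HolAt r y :=
    (show ∀ᶠ y in 𝓝 l, y ∈ U from hU.mem_nhds hl).and hrl.eventually
  have hφ : ∀ α ∈ H.root, ∀ᶠ y in 𝓝 l, DifferentiableAt ℂ (φ α) y ∧
      ∀ i, fderiv ℂ (φ α) y (Pi.single i 1) = (1 - φ α y ^ 2) * dualCoord x α i := by
    intro α hα
    filter_upwards [hgood] with y ⟨hyU, hy⟩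
    refine ⟨(hy (killingForm ℂ 𝔤 (E (-α)) ∘ₗ tensorOp.flip (E α))).differentiableAt, fun i => ?_⟩
    rw [← hE.deriv_of_cdybe x (fun i => partialDeriv r i y) (hr.skew y hyU hy)
      (hr.weight_zero y hyU hy) (hr.cdybe y hyU hy) hα i]
    exact (hy.dual_partialDeriv (killingForm ℂ 𝔤 (E (-α)) ∘ₗ tensorOp.flip (E α)) i).symm
  have htrans : ∀ᶠ y in 𝓝 l, ∀ α ∈ H.root,
      (φ α y - 1) * Complex.exp (α (cartanPoint x (y - l))) * (φ α l + 1) =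
        (φ α y + 1) * Complex.exp (-α (cartanPoint x (y - l))) * (φ α l - 1) :=
    (eventually_all_finset H.root).2 fun α hα => cayley_transport x (hφ α hα)
  have hroot : ∀ y ∈ U, HolAt r y → ∀ α ∈ H.root, tensorOp (r y) (E α) = φ α y • E α :=
    fun y hyU hy α hα => hE.tensorOp_root (hr.weight_zero y hyU hy) hα
  have hgov : ∀ y ∈ U, HolAt r y → (W y : Set (𝔤 × 𝔤)) = cayleySpace H (tensorOp (r y)) :=
    fun y hyU hy => by rw [hW y hyU hy, hE.characteristicSpace_eq]
  filter_upwards [hgood, htrans] with y ⟨hyU, hy⟩ hyt z hz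
  have hcart : ∀ h ∈ H, (h, h) ∈ W y := by
    intro h hh
    change (h, h) ∈ (W y : Set (𝔤 × 𝔤))
    rw [hgov y hyU hy]
    exact ⟨h, hh, 0, by simp, by simp⟩
  have hcay : HasCayleyVectors E (W y) (fun α => φ α y) := by
    intro α hα
    change _ ∈ (W y : Set (𝔤 × 𝔤))
    rw [hgov y hyU hy]
    refine ⟨0, H.zero_mem, E α, fun h hh => hE.killing_cartan hα hh, ?_⟩
    rw [hroot y hyU hy α hα]
    ext <;> simp only <;> module
  have hcay' : HasCayleyVectors E ((W y).map (twist hE (-cartanPoint x (y - l))))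
      (fun α => φ α l) := by
    intro α hα
    rw [mem_map_twist, neg_neg, twist_root hE _ hα]
    have h1 := hyt α hα
    -- The components of a Cayley vector differ by `2 E α`, so the scalar is half the difference of
    -- the twisted components; `h1` says that the two vectors are proportional.
    have h2 := (W y).smul_mem ((Complex.exp (α (cartanPoint x (y - l))) * (φ α l + 1) -
      Complex.exp (-α (cartanPoint x (y - l))) * (φ α l - 1)) / 2) (hcay α hα)
    convert h2 using 1
    ext
    · simp only [Prod.smul_fst, smul_smul]
      congr 1
      linear_combination -(1 / 2 : ℂ) * h1
    · simp only [Prod.smul_snd, smul_smul]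
      congr 1
      linear_combination -(1 / 2 : ℂ) * h1
  have h3 : z ∈ (W l : Set (𝔤 × 𝔤)) := hz
  rw [hgov l hl hrl] at h3
  have h4 := hcay'.cayleySpace_subset hE (cartan_mem_map_twist hE hcart _)
    (fun α hα => hroot l hl hrl α hα) h3
  have h5 := (mem_map_twist hE _).1 h4
  rwa [neg_neg] at h5

/-- The family, transported back to the base point. -/
def untwist (hE : IsRootVectors E) (μ : Fin n → ℂ)
    (W : (Fin n → ℂ) → LieSubalgebra ℂ (𝔤 × 𝔤)) (y : Fin n → ℂ) : LieSubalgebra ℂ (𝔤 × 𝔤) :=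
  (W y).map (twist hE (-cartanPoint x (y - μ)))

variable {x} in
theorem mem_untwist {hE : IsRootVectors E} {μ : Fin n → ℂ}
    {W : (Fin n → ℂ) → LieSubalgebra ℂ (𝔤 × 𝔤)} {y : Fin n → ℂ} {z : 𝔤 × 𝔤} :
    z ∈ untwist x hE μ W y ↔ twist hE (cartanPoint x (y - μ)) z ∈ W y := by
  rw [untwist, mem_map_twist, neg_neg]

/-- The point `l` may be a pole of `r`. The constant value is read off at a nearby holomorphic point
`y₀` and spread over a whole ball around `l` by analytic continuation. -/
theorem untwist_locally_constant (hE : IsRootVectors E) (b : (rootSystem H).Base)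
    (μ : Fin n → ℂ)
    {U : Set (Fin n → ℂ)} (hU : IsOpen U) {W : (Fin n → ℂ) → LieSubalgebra ℂ (𝔤 × 𝔤)}
    (hL : IsLagrangianFamily U W)
    {r : (Fin n → ℂ) → 𝔤 ⊗[ℂ] 𝔤} (hr : IsDynamicalRMatrix H x U r)
    (hW : IsGovernedBy H b E U W r) {l : Fin n → ℂ} (hl : l ∈ U) :
    ∃ V, ∀ᶠ y in 𝓝 l, untwist x hE μ W y = V := by
  obtain ⟨d, s, hs, hspan⟩ := hL.holomorphic l hl
  have hs' : ∀ᶠ y in 𝓝 l, ∀ j, HolAt (s j) y := eventually_all.2 fun j => (hs j).eventually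
  obtain ⟨ε, hε, hball⟩ := Metric.eventually_nhds_iff_ball.1
    ((show ∀ᶠ y in 𝓝 l, y ∈ U from hU.mem_nhds hl).and (hs'.and hspan))
  obtain ⟨y₀, hy₀r, hy₀⟩ := ((hr.meromorphic.frequently_holAt hl).and_eventually
    (Metric.ball_mem_nhds l hε)).exists
  have hy₀U := (hball y₀ hy₀).1
  refine ⟨untwist x hE μ W y₀, Metric.eventually_nhds_iff_ball.2 ⟨ε, hε, fun y hy => ?_⟩⟩
  have hLag : ∀ y ∈ Metric.ball l ε, IsLagrangian (W y) := fun y hy =>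
    hL.lagrangian y (hball y hy).1
  refine (IsLagrangian.eq_of_le ((hLag y₀ hy₀).map_twist hE _) ((hLag y hy).map_twist hE _)
    fun w hw => ?_).symm
  rw [← untwist, mem_untwist] at hw ⊢
  have hnear : ∀ᶠ y in 𝓝 y₀, twist hE (cartanPoint x (y - μ)) w ∈ W y := by
    filter_upwards [eventually_twist_mem x hE b hU hr hW hy₀U hy₀r] with y hy
    have h1 := hy _ hw
    rw [← twist_add] at h1
    have h2 : cartanPoint x (y - y₀) + cartanPoint x (y₀ - μ) = cartanPoint x (y - μ) := by
      simp only [cartanPoint_sub]; abel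
    rwa [h2] at h1
  -- The pairing of a holomorphic section of the bundle with the transported vector is analytic on
  -- the ball and vanishes near `y₀` by isotropy, hence everywhere. A vector orthogonal to the
  -- Lagrangian `W y` lies in it.
  have hzero : ∀ j, doubleBilin 𝔤 (s j y) (twist hE (cartanPoint x (y - μ)) w) = 0 := by
    intro j
    have han : AnalyticOnNhd ℂ
        (fun y => doubleBilin 𝔤 (s j y) (twist hE (cartanPoint x (y - μ)) w))
        (Metric.ball l ε) := fun y hy =>
      HolAt.bilin _ ((hball y hy).2.1 j) (holAt_twist x hE μ w y)
    refine han.eqOn_zero_of_preconnected_of_eventuallyEq_zero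
      (convex_ball l ε).isPreconnected hy₀ ?_ hy
    filter_upwards [hnear, Metric.isOpen_ball.mem_nhds hy₀] with v hv hvB
    have h1 : s j v ∈ (W v).toSubmodule := by
      rw [← (hball v hvB).2.2.2]
      exact Submodule.subset_span ⟨j, rfl⟩
    rw [doubleBilin_apply]
    exact (hLag v hvB).isotropic _ h1 _ hv
  refine (hLag y hy).mem_of_orthogonal fun v hv => ?_
  have hv' : v ∈ Submodule.span ℂ (Set.range fun j => s j y) := by
    rw [(hball y hy).2.2.2]; exact hv
  have hle : Submodule.span ℂ (Set.range fun j => s j y) ≤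
      LinearMap.ker ((doubleBilin 𝔤).flip (twist hE (cartanPoint x (y - μ)) w)) := by
    rw [Submodule.span_le]
    rintro _ ⟨j, rfl⟩
    exact hzero j
  rw [← doubleBilin_apply]
  exact hle hv'

/-- The untwisted family is locally constant on the connected set `U`, hence constant. -/
theorem eq_map_twist_of_isGovernedBy (hE : IsRootVectors E) (b : (rootSystem H).Base)
    {U : Set (Fin n → ℂ)} (hU : IsOpen U) (hUc : IsConnected U)
    {μ : Fin n → ℂ} (hμ : μ ∈ U) {W : (Fin n → ℂ) → LieSubalgebra ℂ (𝔤 × 𝔤)}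
    (hL : IsLagrangianFamily U W)
    {r : (Fin n → ℂ) → 𝔤 ⊗[ℂ] 𝔤} (hr : IsDynamicalRMatrix H x U r)
    (hW : IsGovernedBy H b E U W r) {l : Fin n → ℂ} (hl : l ∈ U) :
    W l = (W μ).map (twist hE (cartanPoint x (l - μ))) := by
  have : PreconnectedSpace U := Subtype.preconnectedSpace hUc.isPreconnected
  have hloc : IsLocallyConstant (fun y : U => untwist x hE μ W y) := by
    refine (IsLocallyConstant.iff_eventually_eq _).2 fun y => ?_
    obtain ⟨V, hV⟩ := untwist_locally_constant x hE b μ hU hL hr hW y.2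
    have h1 := continuous_subtype_val.continuousAt.eventually hV
    filter_upwards [h1] with z hz
    rw [hz, hV.self_of_nhds]
  have h1 : untwist x hE μ W l = untwist x hE μ W μ :=
    hloc.apply_eq_of_preconnectedSpace ⟨l, hl⟩ ⟨μ, hμ⟩
  refine SetLike.ext fun z => ?_
  have h2 : twist hE (-cartanPoint x (l - μ)) z ∈ untwist x hE μ W l ↔
    twist hE (-cartanPoint x (l - μ)) z ∈ untwist x hE μ W μ := by rw [h1]
  rw [mem_untwist, mem_untwist, twist_twist_neg, sub_self, cartanPoint_zero, twist_zero] at h2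
  rw [h2, mem_map_twist]

end

end DynamicalR

end

theorem corollary5p6 {𝔤 : Type*} [LieRing 𝔤] [LieAlgebra ℂ 𝔤] [FiniteDimensional ℂ 𝔤]
    [LieAlgebra.IsSimple ℂ 𝔤] (H : LieSubalgebra ℂ 𝔤) [H.IsCartanSubalgebra]
    (b : (LieAlgebra.IsKilling.rootSystem H).Base)
    (E : LieModule.Weight ℂ H 𝔤 → 𝔤)
    (hE : ∀ α ∈ H.root, E α ∈ LieAlgebra.rootSpace H α)
    (hE1 : ∀ α ∈ H.root, killingForm ℂ 𝔤 (E α) (E (-α)) = 1)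
    {n : ℕ} (x : Module.Basis (Fin n) ℂ H)
    (U : Set (Fin n → ℂ)) (hU : IsOpen U) (hUc : IsConnected U)
    (μ : Fin n → ℂ) (hμ : μ ∈ U)
    (W₀ : LieSubalgebra ℂ (𝔤 × 𝔤)) (hW₀ : DynamicalR.IsLagrangian W₀)
    (hW₀H : DynamicalR.MeetsDiagonalIn H W₀) :
    ∃ W : (Fin n → ℂ) → LieSubalgebra ℂ (𝔤 × 𝔤),
      DynamicalR.IsLagrangianFamily U W ∧ W μ = W₀ ∧
      (∃ r : (Fin n → ℂ) → 𝔤 ⊗[ℂ] 𝔤,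
        DynamicalR.IsDynamicalRMatrix H x U r ∧ DynamicalR.IsGovernedBy H b E U W r ∧
        ∀ l ∈ U, DynamicalR.HolAt r l ↔ DynamicalR.MeetsDiagonalIn H (W l)) ∧
      ∀ W' : (Fin n → ℂ) → LieSubalgebra ℂ (𝔤 × 𝔤),
        DynamicalR.IsLagrangianFamily U W' → W' μ = W₀ →
        (∃ r' : (Fin n → ℂ) → 𝔤 ⊗[ℂ] 𝔤,
          DynamicalR.IsDynamicalRMatrix H x U r' ∧ DynamicalR.IsGovernedBy H b E U W' r') →
        ∀ l ∈ U, W' l = W l := by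
  have hR : DynamicalR.IsRootVectors E := ⟨hE, hE1⟩
  obtain ⟨φ₀, hφ₀⟩ := hR.exists_cayley hW₀ hW₀H
  refine ⟨fun y => W₀.map (DynamicalR.twist hR (DynamicalR.cartanPoint x (y - μ))),
    DynamicalR.isLagrangianFamily_map_twist x μ hR hW₀ U, DynamicalR.map_twist_base x μ hR W₀,
    ⟨fun y => DynamicalR.rootTensor E (DynamicalR.cayleyQuot x μ φ₀ y),
      DynamicalR.isDynamicalRMatrix_rootTensor x μ φ₀ hR hW₀ hφ₀ U,
      DynamicalR.isGovernedBy_rootTensor x μ φ₀ hR b hW₀ hW₀H hφ₀ U, fun l _ => ?_⟩, ?_⟩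
  · rw [DynamicalR.holAt_rootTensor_iff x μ φ₀ hR,
      DynamicalR.meetsDiagonalIn_map_twist_iff hR hW₀ hW₀H hφ₀]
  · rintro W' hL hW'μ ⟨r', hr', hgov⟩ l hl
    rw [DynamicalR.eq_map_twist_of_isGovernedBy x hR b hU hUc hμ hL hr' hgov hl, hW'μ]
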